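/- **Proposition (Hybrid returns UST).** Let $G$ be the complete graph with self-loops on a finite nonempty vertex set $V$ (every two vertices are adjacent and every vertex is adjacent to itself), let $r \in V$ and let $i \ge 0$ be an integer. Let $(X_t)_{t\ge 0}$ be the simple random walk on $G$ with $X_0=r$, let $V_t=\{X_0,\dots,X_t\}$, let $\eta=\inf\{t : V_t=V\}$ be the cover time, and put $\sigma^{\rm in}_0=0$ and, for $j\ge 1$, $$\sigma^{\rm out}_j=\inf\{t>\sigma^{\rm in}_{j-1} : X_t\notin V_{t-1}\}\wedge\eta,\qquad \sigma^{\rm in}_j=\inf\{t>\sigma^{\rm out}_j : X_t\in V_{t-1}\}\wedge\eta .$$ Let $\mathcal T^{AB}_{\sigma^{\rm in}_i}$ be the random tree built by the first $i$ branches of the Aldous–Broder algorithm: its vertex set is $V_{\sigma^{\rm in}_i}$ and its edges are the $\{X_t,X_{t+1}\}$ with $t<\sigma^{\rm in}_i$ and $X_{t+1}\notin V_t$. Run Wilson's algorithm on $G$ with initial condition $\mathcal T^{AB}_{\sigma^{\rm in}_i}$: starting from $(V_X,E_X)$ equal to the vertex set and the edge set of this tree, while $V_X\ne V$, choose $v\in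 V\setminus V_X$ uniformly at random, run a fresh simple random walk on $G$ from $v$ until it first visits $V_X$, erase its loops in chronological order, and add the vertices and the edges of the resulting path to $V_X$ and $E_X$; then return $(V_X,E_X)$. Then this procedure terminates almost surely, and the graph that it returns is a uniform spanning tree of $G$, that is, it is distributed uniformly on the set of all spanning trees of $G$. -/

import Mathlib

open MeasureTheory ProbabilityTheory

noncomputable section

namespace HybridUST

/-! ### Graphs with self-loops, spanning trees -/

/-- A graph on `V` without multiple edges, in which self-loops are allowed. -/
structure LoopGraph (V : Type*) where
  Adj : V → V → Prop
  symm : ∀ v w, Adj v w → Adj w v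

/-- The complete graph with self-loops: any two vertices are adjacent, and every vertex is adjacent
to itself. -/
def completeWithLoops (V : Type*) : LoopGraph V where
  Adj := fun _ _ => True
  symm := fun _ _ _ => trivial

/-- The graph obtained by deleting the self-loops. -/
def LoopGraph.toSimple {V : Type*} (G : LoopGraph V) : SimpleGraph V where
  Adj := fun v w => v ≠ w ∧ G.Adj v w
  symm := ⟨fun v w h => ⟨h.1.symm, G.symm v w h.2⟩⟩
  loopless := ⟨fun _ h => h.1 rfl⟩

/-- The set of spanning trees of `G`. (A tree has no self-loop.) -/
def spanningTrees {V : Type*} (G : LoopGraph V) : Set (SimpleGraph V) :=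
  {T | T ≤ G.toSimple ∧ T.IsTree}

/-- A pair (vertex set, edge set) on the ground set `V`: the variable `(V_X, E_X)` of the
algorithms. -/
@[ext]
structure PartialTree (V : Type*) where
  verts : Set V
  edges : Set (Sym2 V)

/-- A graph on all of `V`, as a pair (vertex set, edge set). -/
def ofSimpleGraph {V : Type*} (T : SimpleGraph V) : PartialTree V := ⟨Set.univ, T.edgeSet⟩

instance {V : Type*} : MeasurableSpace (SimpleGraph V) := ⊤

instance {V : Type*} : MeasurableSpace (PartialTree V) := ⊤

/-- The outcome of a randomized procedure which may fail to terminate: `none` means that it does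
not terminate, `some T` that it terminates and returns `T`. -/
abbrev Outcome (V : Type*) := Option (PartialTree V)

instance {V : Type*} : MeasurableSpace (Outcome V) := ⊤

/-- Run a procedure on the output of an earlier one (if the earlier one has terminated). -/
def andThen {V : Type*} (run : PartialTree V → Measure (Outcome V)) :
    Outcome V → Measure (Outcome V)
  | none => Measure.dirac none
  | some T => run T

/-- `UST(G)`: the uniform probability measure on the set of spanning trees of `G`. -/
def UST {V : Type*} (G : LoopGraph V) : Measure (SimpleGraph V) := uniformOn (spanningTrees G)

/-! ### Simple random walk -/

section Walk

variable {V : Type*} [Finite V] [MeasurableSpace V] [DiscreteMeasurableSpace V]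

open Classical in
/-- One step of simple random walk from `v`: uniform on the neighbours of `v` (a vertex with a
self-loop is a neighbour of itself). At a vertex without neighbours the walk stays put. -/
def stepLaw (G : LoopGraph V) (v : V) : Measure V :=
  if {w | G.Adj v w}.Nonempty then uniformOn {w | G.Adj v w} else Measure.dirac v

instance (G : LoopGraph V) (v : V) : IsProbabilityMeasure (stepLaw G v) := by
  unfold stepLaw
  split_ifs with h
  · exact isProbabilityMeasure_uniformOn (Set.toFinite _) h
  · infer_instance

/-- The transition kernel of simple random walk at time `t`, as a function of the past
`(x_0, …, x_t)`: it depends on `x_t` only. -/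
def stepKernel (G : LoopGraph V) (t : ℕ) :
    Kernel (Π _ : Finset.Iic t, V) V where
  toFun := fun x => stepLaw G (x ⟨t, Finset.mem_Iic.2 le_rfl⟩)
  measurable' := (Measurable.of_discrete (f := stepLaw G)).comp (measurable_pi_apply _)

instance (G : LoopGraph V) (t : ℕ) : IsMarkovKernel (stepKernel G t) :=
  ⟨fun x => inferInstanceAs (IsProbabilityMeasure (stepLaw G (x ⟨t, _⟩)))⟩

/-- The law, on the space of trajectories, of simple random walk on `G` started at `v`. -/
def walkLaw (G : LoopGraph V) (v : V) : Measure (ℕ → V) :=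
  Kernel.trajMeasure (X := fun _ => V) (Measure.dirac v) (stepKernel G)

end Walk

/-! ### Aldous-Broder and its branches -/

section AldousBroder

variable {V : Type*}

/-- `V_t`, the set of vertices visited up to time `t`. -/
def visited (X : ℕ → V) (t : ℕ) : Set V := {v | ∃ k ≤ t, X k = v}

/-- `X_t ∉ V_{t-1}`: the walk is at time `t` at a vertex that it visits for the first time. -/
def Fresh (X : ℕ → V) (t : ℕ) : Prop := ∀ k < t, X k ≠ X t

/-- The first time at which `p` holds (`⊤` if there is none). -/
def firstTime (p : ℕ → Prop) : ℕ∞ := sInf {s : ℕ∞ | ∃ t : ℕ, s = t ∧ p t}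

/-- The cover time `η`. -/
def coverTime (X : ℕ → V) : ℕ∞ := firstTime fun t => visited X t = Set.univ

/-- `inf {t > s : X_t ∉ V_{t-1}} ∧ η`. -/
def nextOut (X : ℕ → V) (s : ℕ∞) : ℕ∞ :=
  min (firstTime fun t => s < t ∧ Fresh X t) (coverTime X)

/-- `inf {t > s : X_t ∈ V_{t-1}} ∧ η`. -/
def nextIn (X : ℕ → V) (s : ℕ∞) : ℕ∞ :=
  min (firstTime fun t => s < t ∧ ¬ Fresh X t) (coverTime X)

/-- `σ^in_i`, the time at which the `i`-th branch is finished: `σ^in_0 = 0`,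
`σ^out_{i+1} = inf {t > σ^in_i : X_t ∉ V_{t-1}} ∧ η` and
`σ^in_{i+1} = inf {t > σ^out_{i+1} : X_t ∈ V_{t-1}} ∧ η`. -/
def sigmaIn (X : ℕ → V) : ℕ → ℕ∞
  | 0 => 0
  | i + 1 => nextIn X (nextOut X (sigmaIn X i))

/-- The tree built by Aldous-Broder up to time `t`: the visited vertices, and the edges
`{X_k, X_{k+1}}` through which a vertex is entered for the first time. -/
def aldousBroderTree (X : ℕ → V) (t : ℕ) : PartialTree V where
  verts := visited X t
  edges := {e | ∃ k < t, Fresh X (k + 1) ∧ e = s(X k, X (k + 1))}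

open Classical in
/-- The tree built by the first `i` branches, that is up to time `σ^in_i`. -/
def branchTree (i : ℕ) (X : ℕ → V) : Outcome V :=
  if sigmaIn X i = ⊤ then none else some (aldousBroderTree X (sigmaIn X i).toNat)

/-- The law of the random tree built by the first `i` branches of Aldous-Broder started at `r`. -/
def aldousBroderLaw [Finite V] [MeasurableSpace V] [DiscreteMeasurableSpace V]
    (G : LoopGraph V) (r : V) (i : ℕ) : Measure (Outcome V) :=
  (walkLaw G r).map (branchTree i)

end AldousBroder

/-! ### Wilson's algorithm with an initial tree -/

section Wilson

variable {V : Type*}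

open Classical in
/-- Extend a self-avoiding path by one step of the walk, to `v`. If `v` is on the path already, the
loop that is closed at `v` is erased: the path is cut back to its part that ends in `v`. -/
def eraseStep (p : List V) (v : V) : List V := p.takeWhile (fun u => u ≠ v) ++ [v]

/-- Chronological loop erasure of a finite walk. -/
def loopErase (w : List V) : List V := w.foldl eraseStep []

/-- The edges of a path. -/
def pathEdges (p : List V) : Set (Sym2 V) := {e | e ∈ List.zipWith (fun a b => s(a, b)) p p.tail}

open Classical in
/-- Follow the trajectory `X` until it first visits `T`, and add the loop erasure of this piece of
trajectory to `T`. -/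
def addBranch (T : PartialTree V) (X : ℕ → V) : Outcome V :=
  let τ := firstTime fun t => X t ∈ T.verts
  if τ = ⊤ then none else
    let p := loopErase ((List.range (τ.toNat + 1)).map X)
    some ⟨T.verts ∪ {v | v ∈ p}, T.edges ∪ pathEdges p⟩

variable [Finite V] [MeasurableSpace V] [DiscreteMeasurableSpace V]

/-- One round of the while loop: choose a vertex outside the tree uniformly at random, start a
random walk there, and add the loop-erased walk to the tree. -/
def wilsonRound (G : LoopGraph V) (T : PartialTree V) : Measure (Outcome V) :=
  (uniformOn T.vertsᶜ).bind fun v => (walkLaw G v).map (addBranch T)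

open Classical in
/-- The while loop, with at most `k` rounds; running out of rounds counts as non-termination. -/
def wilsonLoop (G : LoopGraph V) : ℕ → PartialTree V → Measure (Outcome V)
  | 0, T => Measure.dirac (if T.verts = Set.univ then some T else none)
  | k + 1, T =>
    if T.verts = Set.univ then Measure.dirac (some T)
    else (wilsonRound G T).bind (andThen (wilsonLoop G k))

/-- The law of the outcome of Wilson's algorithm on `G` with the (nonempty) initial tree `T`. Each
round of the while loop adds a vertex, so that there are at most `|V|` rounds. -/
def wilson (G : LoopGraph V) (T : PartialTree V) : Measure (Outcome V) :=
  wilsonLoop G (Nat.card V) T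

end Wilson

end HybridUST

end

namespace HybridUST

/-! ### Simple random walk on the complete graph -/

/-! Fix a spanning tree S and put n = |V|. A tree on k vertices containing r gets the value n^(k+1)
/ (k n^n) if it is contained in S, and 0 otherwise (`value`). This is the reciprocal of the number
of spanning trees extending a given tree on k vertices, but that count is not needed. The point is
that the value is conserved in expectation, both by a Wilson branch started at any vertex outside
the tree (`integral_value_addBranch`) and by the first i Aldous–Broder branches as a whole
(`integral_value_branchTree`). On a spanning tree the value is the indicator of being S. Hence the
procedure returns S with probability equal to the value of the one-vertex tree, which does not
depend on S. A probability measure that is constant on the spanning trees and carried by them is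
uniform, so Cayley's formula is never used.

Each conservation law is proved by guessing the conditional expectation given the past and checking
the one-step equation. The difference between the true expectation and the guess is then bounded and
satisfies n Ψ(s) = sum of Ψ over the successors in a proper subset B of V, so it vanishes by
contraction (`eq_zero_of_killed`).

For Wilson the guess depends on the current loop erasure only: on how many of its first vertices
follow the path in S from v towards the tree, and on whether it has left that path
(`chainProb_step`). For Aldous–Broder, while a branch ends at y in a compatible tree on k vertices,
the guess is n^(k-n) times the number of descendants of y in S (`branchMean_out`). Between branches
the expectation depends on the position of the walk. Only its average over the visited vertices
equals the value of the tree (`sum_branchMean_in`). This average suffices because on the complete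
graph with loops a step into the visited set is uniform there, wherever the walk was. -/

/-- The trajectories which agree with `x` up to time `t`. -/
def cyl {V : Type*} (t : ℕ) (x : ℕ → V) : Set (ℕ → V) := {y | ∀ j ≤ t, y j = x j}

section WalkLemmas

variable {V : Type*}

theorem mem_cyl_self (t : ℕ) (x : ℕ → V) : x ∈ cyl t x := fun _ _ => rfl

theorem cyl_succ_eq (t : ℕ) (x : ℕ → V) (w : V) :
    cyl (t + 1) (Function.update x (t + 1) w) = cyl t x ∩ {y | y (t + 1) = w} := by
  ext y
  constructor
  · intro h
    refine ⟨fun j hj => ?_, ?_⟩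
    · rw [h j (by omega), Function.update_of_ne (by omega)]
    · simpa using h (t + 1) le_rfl
  · rintro ⟨h1, h2⟩ j hj
    rcases Nat.lt_or_ge j (t + 1) with h | h
    · rw [Function.update_of_ne (by omega)]
      exact h1 j (by omega)
    · obtain rfl : j = t + 1 := by omega
      simpa using h2

theorem card_pos_real [Fintype V] [Nonempty V] : (0 : ℝ) < Fintype.card V := by
  exact_mod_cast Fintype.card_pos

/-- A bounded function on the states of a walk which is harmonic with killing outside `B`
vanishes. -/
theorem eq_zero_of_killed [Fintype V] {σ : Type*} (alive : σ → Prop) (step : σ → V → σ)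
    (B : Finset V) (hB : B.card < Fintype.card V) (Ψ : σ → ℝ) (K : ℝ)
    (hK : ∀ s, alive s → |Ψ s| ≤ K)
    (hstep : ∀ s, alive s → ∀ w ∈ B, alive (step s w))
    (hΨ : ∀ s, alive s → (Fintype.card V : ℝ) * Ψ s = ∑ w ∈ B, Ψ (step s w))
    {s : σ} (hs : alive s) : Ψ s = 0 := by
  set n : ℝ := (Fintype.card V : ℝ) with hn
  have hn0 : 0 < n := by rw [hn]; exact_mod_cast (by omega : 0 < Fintype.card V)
  set q : ℝ := B.card / n with hq
  have hq0 : 0 ≤ q := by positivity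
  have hq1 : q < 1 := by rw [hq, div_lt_one hn0, hn]; exact_mod_cast hB
  -- Each application of the averaging identity shrinks the bound by |B|/n < 1.
  have main : ∀ j : ℕ, ∀ s, alive s → |Ψ s| ≤ q ^ j * K := by
    intro j
    induction j with
    | zero => simpa using hK
    | succ j ih =>
      intro s hs
      have h1 : n * |Ψ s| ≤ B.card * (q ^ j * K) := by
        rw [← abs_of_pos hn0, ← abs_mul, hΨ s hs, ← nsmul_eq_mul]
        exact (Finset.abs_sum_le_sum_abs _ _).trans
          (Finset.sum_le_card_nsmul _ _ _ fun w hw => ih _ (hstep s hs w hw))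
      rw [pow_succ, hq]
      rw [hq] at h1
      calc |Ψ s| ≤ (B.card * ((B.card / n) ^ j * K)) / n := by
            rw [le_div_iff₀ hn0]; linarith
        _ = _ := by ring
  have hlim : Filter.Tendsto (fun j : ℕ => q ^ j * K) Filter.atTop (nhds (0 * K)) :=
    (tendsto_pow_atTop_nhds_zero_of_lt_one hq0 hq1).mul_const K
  have := ge_of_tendsto' hlim fun j => main j s hs
  rw [zero_mul] at this
  exact abs_nonpos_iff.1 this

variable [MeasurableSpace V] [DiscreteMeasurableSpace V]

theorem measurableSet_cyl (t : ℕ) (x : ℕ → V) : MeasurableSet (cyl t x) := by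
  have : cyl t x = ⋂ j ∈ Set.Iic t, (fun y : ℕ → V => y j) ⁻¹' {x j} := by
    ext y; simp [cyl]
  rw [this]
  exact MeasurableSet.biInter (Set.to_countable _)
    fun j _ => measurable_pi_apply j (MeasurableSet.of_discrete)

variable [Fintype V]

instance (G : LoopGraph V) (v : V) : IsProbabilityMeasure (walkLaw G v) := by
  unfold walkLaw; infer_instance

theorem stepLaw_complete (v w : V) :
    stepLaw (completeWithLoops V) v {w} = (Fintype.card V : ENNReal)⁻¹ := by
  have h : {w | (completeWithLoops V).Adj v w} = Set.univ := by
    ext; simp [completeWithLoops]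
  unfold stepLaw
  rw [h, if_pos ⟨v, trivial⟩, uniformOn_univ]
  simp

theorem walkLaw_zero (G : LoopGraph V) (v : V) :
    (walkLaw G v).map (fun x => x 0) = Measure.dirac v := by
  have h1 : (fun x : ℕ → V => x 0) =
      (fun y : (Π _ : Finset.Iic 0, V) => y ⟨0, by simp⟩) ∘ Preorder.frestrictLe 0 := rfl
  rw [h1, ← Measure.map_map (by fun_prop) (by fun_prop), walkLaw, Kernel.trajMeasure,
    Measure.map_comp _ _ (by fun_prop), Kernel.traj_map_frestrictLe, Kernel.partialTraj_self,
    Measure.id_comp, Measure.map_map (by fun_prop) (by fun_prop)]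
  rw [Measure.map_dirac' (by fun_prop)]
  rfl

theorem walkLaw_cyl_zero (G : LoopGraph V) {v : V} {x : ℕ → V} (hx : x 0 = v) :
    walkLaw G v (cyl 0 x) = 1 := by
  have : cyl 0 x = (fun y : ℕ → V => y 0) ⁻¹' {v} := by
    ext y; simp [cyl, hx]
  rw [this, ← Measure.map_apply (by fun_prop) MeasurableSet.of_discrete, walkLaw_zero]
  simp

/-- On the complete graph with loops the step law is uniform from every vertex, so the
composition-product integrates a constant over the past. -/
theorem walkLaw_cyl_succ (v : V) (t : ℕ) (x : ℕ → V) :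
    walkLaw (completeWithLoops V) v (cyl (t + 1) x) =
      (Fintype.card V : ENNReal)⁻¹ * walkLaw (completeWithLoops V) v (cyl t x) := by
  have key := Kernel.map_frestrictLe_trajMeasure_compProd_eq_map_trajMeasure
    (X := fun _ => V) (μ₀ := Measure.dirac v) (κ := stepKernel (completeWithLoops V)) (a := t)
  change (walkLaw (completeWithLoops V) v).map _ ⊗ₘ _ =
    (walkLaw (completeWithLoops V) v).map _ at key
  have h1 : cyl (t + 1) x =
      (fun y : ℕ → V => (Preorder.frestrictLe (π := fun _ => V) t y, y (t + 1))) ⁻¹'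
      ({Preorder.frestrictLe (π := fun _ => V) t x} ×ˢ {x (t + 1)}) := by
    ext y
    simp only [cyl, Set.mem_ofPred_eq, Set.mem_preimage, Set.mem_prod, Set.mem_singleton_iff,
      funext_iff, Preorder.frestrictLe_apply, Subtype.forall, Finset.mem_Iic]
    exact ⟨fun h => ⟨fun j hj => h j (by omega), h _ le_rfl⟩, fun h j hj => by
      rcases Nat.lt_or_ge j (t + 1) with hlt | hge
      · exact h.1 j (by omega)
      · obtain rfl : j = t + 1 := by omega
        exact h.2⟩
  have h2 : cyl t x = (Preorder.frestrictLe (π := fun _ => V) t) ⁻¹'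
      {Preorder.frestrictLe (π := fun _ => V) t x} := by
    ext y
    simp only [cyl, Set.mem_ofPred_eq, Set.mem_preimage, Set.mem_singleton_iff,
      funext_iff, Preorder.frestrictLe_apply, Subtype.forall, Finset.mem_Iic]
  rw [h1, ← Measure.map_apply (by fun_prop)
      ((MeasurableSet.singleton _).prod (MeasurableSet.singleton _)), ← key,
    Measure.compProd_apply_prod (MeasurableSet.singleton _) (MeasurableSet.singleton _)]
  have h3 : ∀ y, stepKernel (completeWithLoops V) t y {x (t + 1)} =
      (Fintype.card V : ENNReal)⁻¹ := fun y => stepLaw_complete _ _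
  simp only [h3, lintegral_const]
  rw [h2, ← Measure.map_apply (by fun_prop) (MeasurableSet.singleton _)]
  simp

theorem walkLaw_real_cyl {v : V} (t : ℕ) {x : ℕ → V} (hx : x 0 = v) :
    (walkLaw (completeWithLoops V) v).real (cyl t x) = ((Fintype.card V : ℝ) ^ t)⁻¹ := by
  induction t with
  | zero => simp [Measure.real, walkLaw_cyl_zero _ hx]
  | succ t ih =>
    rw [Measure.real] at ih ⊢
    rw [walkLaw_cyl_succ, ENNReal.toReal_mul, ih, pow_succ, mul_inv, mul_comm]
    simp

/-- The conditional expectation of `f`, given that the walk follows `x` up to time `t`. -/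
noncomputable def condMean (v : V) (f : (ℕ → V) → ℝ) (t : ℕ) (x : ℕ → V) : ℝ :=
  (Fintype.card V : ℝ) ^ t * ∫ y in cyl t x, f y ∂walkLaw (completeWithLoops V) v

/-- The one-step equation on which every computation rests: a cylinder splits according to the next
vertex, and the factor n makes up for the change of normalization. -/
theorem condMean_step (v : V) {f : (ℕ → V) → ℝ}
    (hf : Integrable f (walkLaw (completeWithLoops V) v)) (t : ℕ) (x : ℕ → V) :
    (Fintype.card V : ℝ) * condMean v f t x =
      ∑ w, condMean v f (t + 1) (Function.update x (t + 1) w) := by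
  have h : cyl t x = ⋃ w : V, cyl (t + 1) (Function.update x (t + 1) w) := by
    ext y; simp [cyl_succ_eq]
  unfold condMean
  rw [← Finset.mul_sum, pow_succ, h, integral_iUnion_fintype]
  · ring
  · exact fun w => measurableSet_cyl _ _
  · intro a b hab
    simp only [Function.onFun, cyl_succ_eq]
    rw [Set.disjoint_left]
    rintro y ⟨_, h1⟩ ⟨_, h2⟩
    exact hab (h1.symm.trans h2)
  · exact fun w => hf.integrableOn

/-- Supplies the boundary values, once the past decides `f`. The condition on `x 0` is needed
because other cylinders are null. -/
theorem condMean_of_const {v : V} {f : (ℕ → V) → ℝ} {t : ℕ} {x : ℕ → V} {c : ℝ} (hx : x 0 = v)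
    (h : ∀ y ∈ cyl t x, f y = c) : condMean v f t x = c := by
  have : Nonempty V := ⟨v⟩
  unfold condMean
  rw [setIntegral_congr_fun (measurableSet_cyl t x) h]
  simp only [integral_const, MeasurableSet.univ, measureReal_restrict_apply, Set.univ_inter,
    walkLaw_real_cyl t hx, smul_eq_mul]
  have := card_pos_real (V := V)
  field_simp

theorem abs_condMean_le {v : V} {f : (ℕ → V) → ℝ} {t : ℕ} {x : ℕ → V} {c : ℝ} (hx : x 0 = v)
    (h : ∀ y, |f y| ≤ c) : |condMean v f t x| ≤ c := by
  have : Nonempty V := ⟨v⟩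
  have h1 := norm_setIntegral_le_of_norm_le_const
    (μ := walkLaw (completeWithLoops V) v) (s := cyl t x) (measure_lt_top _ _)
    (fun y _ => (Real.norm_eq_abs (f y)).le.trans (h y))
  rw [walkLaw_real_cyl t hx, Real.norm_eq_abs] at h1
  have h2 : (0 : ℝ) < (Fintype.card V : ℝ) ^ t := pow_pos card_pos_real t
  unfold condMean
  rw [abs_mul, abs_of_pos h2]
  calc _ ≤ (Fintype.card V : ℝ) ^ t * (c * ((Fintype.card V : ℝ) ^ t)⁻¹) := by gcongr
    _ = c := by field_simp

theorem condMean_zero (v : V) (f : (ℕ → V) → ℝ) {x : ℕ → V} (hx : x 0 = v) :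
    condMean v f 0 x = ∫ y, f y ∂walkLaw (completeWithLoops V) v := by
  unfold condMean
  rw [pow_zero, one_mul, setIntegral_eq_integral_of_ae_compl_eq_zero]
  have h : ∀ᵐ y ∂walkLaw (completeWithLoops V) v, y ∈ cyl 0 x := by
    rw [ae_iff]
    exact (prob_compl_eq_zero_iff (measurableSet_cyl 0 x)).2 (walkLaw_cyl_zero _ hx)
  filter_upwards [h] with y hy hn using absurd hy hn

theorem ae_walkLaw_zero (v : V) : ∀ᵐ x ∂walkLaw (completeWithLoops V) v, x 0 = v := by
  have h : ∀ᵐ y ∂walkLaw (completeWithLoops V) v, y ∈ cyl 0 (fun _ => v) := by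
    rw [ae_iff]
    exact (prob_compl_eq_zero_iff (measurableSet_cyl 0 _)).2 (walkLaw_cyl_zero _ rfl)
  filter_upwards [h] with y hy using hy 0 le_rfl

/-- The conditional probability of never meeting `w` is harmonic for the walk killed at `w`, hence
zero. -/
theorem ae_hits (v w : V) : ∀ᵐ x ∂walkLaw (completeWithLoops V) v, ∃ t, x t = w := by
  classical
  by_cases hvw : v = w
  · filter_upwards [ae_walkLaw_zero v] with y hy using ⟨0, hy.trans hvw⟩
  set E : Set (ℕ → V) := {x | ∀ t, x t ≠ w} with hE
  have hEm : MeasurableSet E := by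
    have : E = ⋂ t, (fun x : ℕ → V => x t) ⁻¹' {w}ᶜ := by ext; simp [hE]
    rw [this]
    exact MeasurableSet.iInter fun t => measurable_pi_apply t MeasurableSet.of_discrete
  have hint : Integrable (E.indicator fun _ => (1 : ℝ)) (walkLaw (completeWithLoops V) v) :=
    (integrable_const 1).indicator hEm
  have key := eq_zero_of_killed (V := V) (σ := ℕ × (ℕ → V))
    (fun s => s.2 0 = v ∧ s.2 s.1 ≠ w) (fun s a => (s.1 + 1, Function.update s.2 (s.1 + 1) a))
    ({w}ᶜ) (by rw [Finset.card_compl]; simp [Fintype.card_pos_iff, Nonempty.intro v])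
    (fun s => condMean v (E.indicator fun _ => (1 : ℝ)) s.1 s.2) 1
    (fun s hs => abs_condMean_le hs.1 fun y => by
      by_cases h : y ∈ E <;> simp [h])
    (fun s hs a ha => by
      refine ⟨by simpa using hs.1, by simpa using ha⟩)
    (fun s hs => by
      rw [condMean_step v hint, Fintype.sum_eq_add_sum_compl w,
        condMean_of_const (c := 0), zero_add]
      · simpa using hs.1
      · intro y hy
        have := hy (s.1 + 1) le_rfl
        rw [Function.update_self] at this
        exact Set.indicator_of_notMem (fun h : y ∈ E => h _ this) _)
    (s := (0, fun _ => v)) ⟨rfl, hvw⟩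
  simp only at key
  rw [condMean_zero v _ rfl, integral_indicator_const _ hEm, smul_eq_mul, mul_one,
    measureReal_eq_zero_iff] at key
  rw [ae_iff]
  convert key using 2
  ext; simp [hE]

end WalkLemmas

/-! ### Partial trees grown from a root -/

section Trees

variable {V : Type*}

/-- The partial trees which are obtained from the one-vertex tree `r` by adding leaves. -/
inductive Grown (r : V) : PartialTree V → Prop
  | base : Grown r ⟨{r}, ∅⟩
  | step {T : PartialTree V} {x y : V} : Grown r T → x ∈ T.verts → y ∉ T.verts →
      Grown r ⟨insert y T.verts, insert s(x, y) T.edges⟩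

theorem Grown.root_mem {r : V} {T : PartialTree V} (h : Grown r T) : r ∈ T.verts := by
  induction h with
  | base => simp
  | step _ _ _ ih => exact Or.inr ih

theorem Grown.mem_verts {r : V} {T : PartialTree V} (h : Grown r T) :
    ∀ e ∈ T.edges, ∀ v ∈ e, v ∈ T.verts := by
  induction h with
  | base => simp
  | step _ hx _ ih =>
    rintro e (rfl | he) v hv
    · rcases Sym2.mem_iff.1 hv with rfl | rfl
      · exact Or.inr hx
      · exact Or.inl rfl
    · exact Or.inr (ih e he v hv)

theorem Grown.not_isDiag {r : V} {T : PartialTree V} (h : Grown r T) :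
    ∀ e ∈ T.edges, ¬ e.IsDiag := by
  induction h with
  | base => simp
  | step _ hx hy ih =>
    rintro e (rfl | he)
    · rw [Sym2.mk_isDiag_iff]
      rintro rfl
      exact hy hx
    · exact ih e he

theorem Grown.edge_notMem {r : V} {T : PartialTree V} (h : Grown r T) {x y : V}
    (hy : y ∉ T.verts) : s(x, y) ∉ T.edges :=
  fun he => hy (h.mem_verts _ he y (Sym2.mem_mk_right x y))

theorem Grown.ncard_edges [Finite V] {r : V} {T : PartialTree V} (h : Grown r T) :
    T.edges.ncard + 1 = T.verts.ncard := by
  induction h with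
  | base => simp
  | step hT _ hy ih =>
    rw [Set.ncard_insert_of_notMem (hT.edge_notMem hy) (Set.toFinite _),
      Set.ncard_insert_of_notMem hy (Set.toFinite _), ih]

theorem Grown.reachable {r : V} {T : PartialTree V} (h : Grown r T) :
    ∀ v ∈ T.verts, (SimpleGraph.fromEdgeSet T.edges).Reachable r v := by
  induction h with
  | base => rintro v rfl; exact SimpleGraph.Reachable.refl _
  | @step T x y _ hx hy ih =>
    have hle : SimpleGraph.fromEdgeSet T.edges ≤
        SimpleGraph.fromEdgeSet (insert s(x, y) T.edges) :=
      SimpleGraph.fromEdgeSet_mono (Set.subset_insert _ _)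
    rintro v (rfl | hv)
    · refine ((ih x hx).mono hle).trans (SimpleGraph.Adj.reachable ?_)
      rw [SimpleGraph.fromEdgeSet_adj]
      exact ⟨Set.mem_insert _ _, fun h => hy (h ▸ hx)⟩
    · exact (ih v hv).mono hle

/-- Adding leaves keeps the graph connected to the root and keeps one edge fewer than vertices. -/
theorem Grown.exists_isTree [Finite V] {r : V} {T : PartialTree V} (h : Grown r T)
    (hT : T.verts = Set.univ) : ∃ S : SimpleGraph V, S.IsTree ∧ ofSimpleGraph S = T := by
  have hE : (SimpleGraph.fromEdgeSet T.edges).edgeSet = T.edges := by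
    rw [SimpleGraph.edgeSet_fromEdgeSet, sdiff_eq_left, Set.disjoint_left]
    exact fun e he hd => h.not_isDiag e he (by simpa using hd)
  refine ⟨SimpleGraph.fromEdgeSet T.edges, ?_, PartialTree.ext hT.symm hE⟩
  rw [SimpleGraph.isTree_iff_connected_and_card, hE]
  have : Nonempty V := ⟨r⟩
  refine ⟨⟨fun u v => ?_⟩, ?_⟩
  · exact (h.reachable u (hT ▸ trivial)).symm.trans (h.reachable v (hT ▸ trivial))
  · rw [Nat.card_coe_set_eq, h.ncard_edges, hT, Set.ncard_univ]

theorem mem_spanningTrees_complete {S : SimpleGraph V} :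
    S ∈ spanningTrees (completeWithLoops V) ↔ S.IsTree :=
  ⟨fun h => h.2, fun h => ⟨fun _ _ hvw => ⟨hvw.ne, trivial⟩, h⟩⟩

/-! ### The parent function of a rooted tree -/

/-- `par` sends each vertex of the tree `S` other than `r` to its neighbour in the direction
of `r`. -/
structure IsParent (S : SimpleGraph V) (r : V) (par : V → V) : Prop where
  root : par r = r
  reach : ∀ v, ∃ j, par^[j] v = r
  adj : ∀ v, v ≠ r → S.Adj v (par v)
  eq_or_eq : ∀ v w, S.Adj v w → par v = w ∨ par w = v

/-- The parent is a neighbour one step closer to `r`. -/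
theorem exists_isParent [Finite V] {S : SimpleGraph V} (hS : S.IsTree) (r : V) :
    ∃ par, IsParent S r par := by
  classical
  have := Fintype.ofFinite V
  have h1 : ∀ v, v ≠ r → ∃ w, S.Adj v w ∧ S.dist r v = S.dist r w + 1 := by
    intro v hv
    obtain ⟨p, hp⟩ := hS.connected.exists_walk_length_eq_dist v r
    cases p with
    | nil => exact absurd rfl hv
    | @cons _ w _ h p =>
      refine ⟨w, h, ?_⟩
      have h2 := SimpleGraph.dist_le p
      have h3 := hS.connected.dist_triangle (u := v) (v := w) (w := r)
      have h4 := SimpleGraph.dist_eq_one_iff_adj.2 h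
      rw [SimpleGraph.Walk.length_cons] at hp
      rw [SimpleGraph.dist_comm (u := r), SimpleGraph.dist_comm (u := r)]
      omega
  choose! f hf using h1
  set par : V → V := fun v => if v = r then r else f v with hpar
  have hpr : par r = r := by simp [hpar]
  have hpn : ∀ v, v ≠ r → par v = f v := fun v hv => by simp [hpar, hv]
  have hadj : ∀ v, v ≠ r → S.Adj v (par v) := fun v hv => by rw [hpn v hv]; exact (hf v hv).1
  have hdist : ∀ v, v ≠ r → S.dist r v = S.dist r (par v) + 1 :=
    fun v hv => by rw [hpn v hv]; exact (hf v hv).2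
  -- The n - 1 edges {v, par v} are distinct because distances to `r` drop along `par`. A tree has
  -- no more edges than that, so these are all of them.
  have himg : (Finset.univ.erase r).image (fun v => s(v, par v)) = S.edgeFinset := by
    apply Finset.eq_of_subset_of_card_le
    · intro e he
      obtain ⟨v, hv, rfl⟩ := Finset.mem_image.1 he
      rw [SimpleGraph.mem_edgeFinset, SimpleGraph.mem_edgeSet]
      exact hadj v (Finset.ne_of_mem_erase hv)
    · rw [Finset.card_image_of_injOn, Finset.card_erase_of_mem (Finset.mem_univ _),
        Finset.card_univ, ← hS.card_edgeFinset]
      · simp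
      · intro v hv w hw hvw
        have hv' := hdist v (Finset.ne_of_mem_erase hv)
        have hw' := hdist w (Finset.ne_of_mem_erase hw)
        rcases Sym2.eq_iff.1 hvw with h | ⟨h2, h3⟩
        · exact h.1
        · rw [h3] at hv'
          rw [← h2] at hw'
          omega
  refine ⟨par, hpr, ?_, hadj, ?_⟩
  · have : ∀ d v, S.dist r v = d → ∃ j, par^[j] v = r := by
      intro d
      induction d with
      | zero =>
        intro v hv
        exact ⟨0, ((hS.connected.dist_eq_zero_iff).1 hv).symm⟩
      | succ d ih =>
        intro v hv
        by_cases hvr : v = r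
        · exact ⟨0, hvr⟩
        · obtain ⟨j, hj⟩ := ih (par v) (by have := hdist v hvr; omega)
          exact ⟨j + 1, hj⟩
    exact fun v => this _ v rfl
  · intro v w hvw
    have : s(v, w) ∈ S.edgeFinset := by simpa using hvw
    rw [← himg, Finset.mem_image] at this
    obtain ⟨u, -, hu⟩ := this
    rcases Sym2.eq_iff.1 hu with ⟨rfl, h⟩ | ⟨rfl, h⟩
    · exact Or.inl h
    · exact Or.inr h

variable {S : SimpleGraph V} {r : V} {par : V → V}

theorem IsParent.iterate_root (h : IsParent S r par) (j : ℕ) : par^[j] r = r :=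
  Function.iterate_fixed h.root j

/-- If `y` reaches `r` in j steps, then going j times around the cycle takes at least j steps; it
ends at `r` and also at `y`. -/
theorem IsParent.eq_root_of_cycle (h : IsParent S r par) {y : V} {m : ℕ}
    (hm : par^[m + 1] y = y) : y = r := by
  obtain ⟨j, hj⟩ := h.reach y
  have h1 : par^[(m + 1) * j] y = y := by
    rw [Function.iterate_mul]
    exact Function.iterate_fixed hm j
  have h2 : (m + 1) * j = m * j + j := by ring
  rw [h2, Function.iterate_add_apply, hj, h.iterate_root] at h1
  exact h1.symm

theorem iterate_mem {A : Set V} (hA : ∀ v ∈ A, par v ∈ A) {v : V} (hv : v ∈ A) (j : ℕ) :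
    par^[j] v ∈ A := by
  induction j with
  | zero => exact hv
  | succ j ih => rw [Function.iterate_succ_apply']; exact hA _ ih

/-- A subtree of `S` that contains `r` is closed under `par`. When a leaf `y` is hung on `x`, `x` is
the parent of `y`: the other orientation would put `y`, as parent of `x`, into the tree already. -/
theorem Grown.parent_mem {T : PartialTree V} (hT : Grown r T) (h : IsParent S r par) :
    T.edges ⊆ S.edgeSet → ∀ v ∈ T.verts, v ≠ r → par v ∈ T.verts ∧ s(v, par v) ∈ T.edges := by
  induction hT with
  | base => rintro - v rfl hv; exact absurd rfl hv
  | @step T x y hT hx hy ih =>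
    intro hs v hv hvr
    have hT' := ih ((Set.subset_insert _ _).trans hs)
    rcases hv with rfl | hv
    · have hxv : S.Adj x v := hs (Set.mem_insert _ _)
      have : par v = x := by
        rcases h.eq_or_eq x v hxv with h1 | h1
        · by_cases hxr : x = r
          · rw [hxr, h.root] at h1
            exact absurd h1.symm hvr
          · exact absurd (h1 ▸ (hT' x hx hxr).1) hy
        · exact h1
      rw [this, Sym2.eq_swap]
      exact ⟨Or.inr hx, Or.inl rfl⟩
    · exact ⟨Or.inr (hT' v hv hvr).1, Or.inr (hT' v hv hvr).2⟩

theorem Grown.parent_closed {T : PartialTree V} (hT : Grown r T) (h : IsParent S r par)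
    (hs : T.edges ⊆ S.edgeSet) : ∀ v ∈ T.verts, par v ∈ T.verts := by
  intro v hv
  by_cases hvr : v = r
  · rw [hvr, h.root]; exact hT.root_mem
  · exact (hT.parent_mem h hs v hv hvr).1

/-- The test for compatibility with `S` of a step that discovers `y` from `x`. -/
theorem Grown.insert_subset_iff {T : PartialTree V} (hT : Grown r T) (h : IsParent S r par)
    {x y : V} (hx : x ∈ T.verts) (hy : y ∉ T.verts) :
    insert s(x, y) T.edges ⊆ S.edgeSet ↔ T.edges ⊆ S.edgeSet ∧ par y = x := by
  have hyr : y ≠ r := fun hyr => hy (hyr ▸ hT.root_mem)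
  constructor
  · intro hs
    refine ⟨(Set.subset_insert _ _).trans hs, ?_⟩
    have h1 := (hT.step hx hy).parent_mem h hs y (Or.inl rfl) hyr
    rcases h1.2 with h2 | h2
    · rcases Sym2.eq_iff.1 h2 with h3 | h3
      · exact absurd (h3.1 ▸ hx) hy
      · exact h3.2
    · rw [Sym2.eq_swap] at h2
      exact absurd h2 (hT.edge_notMem hy)
  · rintro ⟨hs, rfl⟩
    refine Set.insert_subset ?_ hs
    exact (h.adj y hyr).symm

theorem Grown.subset_iff_of_verts_eq_univ {T : PartialTree V} (hT : Grown r T)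
    (h : IsParent S r par) (hu : T.verts = Set.univ) :
    T.edges ⊆ S.edgeSet ↔ T = ofSimpleGraph S := by
  constructor
  · intro hs
    refine PartialTree.ext hu (hs.antisymm ?_)
    intro e
    induction e with
    | _ v w =>
      intro hvw
      rcases h.eq_or_eq v w hvw with rfl | rfl
      · refine (hT.parent_mem h hs v (hu ▸ trivial) ?_).2
        rintro rfl
        exact hvw.ne h.root.symm
      · rw [Sym2.eq_swap]
        refine (hT.parent_mem h hs w (hu ▸ trivial) ?_).2
        rintro rfl
        exact hvw.ne h.root
  · rintro rfl
    exact subset_rfl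

/-! ### Descendants -/

section Descendants

variable [Fintype V]

open Classical in
/-- The descendants of `y`, including `y` itself. -/
noncomputable def desc (par : V → V) (y : V) : Finset V :=
  Finset.univ.filter fun v => ∃ j, par^[j] v = y

theorem mem_desc {y v : V} : v ∈ desc par y ↔ ∃ j, par^[j] v = y := by simp [desc]

variable [DecidableEq V]

/-- The descendants split into `y` and the subtrees of its children. A common descendant of two
children would give a cycle through `y`, forcing `y = r` and then one of the children to be `r`. -/
theorem IsParent.card_desc (h : IsParent S r par) (y : V) :
    (desc par y).card =
      1 + ∑ z ∈ Finset.univ.filter (fun z => z ≠ r ∧ par z = y), (desc par z).card := by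
  have h1 : desc par y = insert y
      ((Finset.univ.filter fun z => z ≠ r ∧ par z = y).biUnion (desc par)) := by
    ext v
    simp only [mem_desc, Finset.mem_insert, Finset.mem_biUnion, Finset.mem_filter,
      Finset.mem_univ, true_and]
    constructor
    · rintro ⟨j, hj⟩
      induction j with
      | zero => exact Or.inl hj
      | succ j ih =>
        by_cases hz : par^[j] v = r
        · apply ih
          rw [Function.iterate_succ_apply', hz, h.root] at hj
          rw [hz, hj]
        · refine Or.inr ⟨par^[j] v, ⟨hz, ?_⟩, j, rfl⟩
          rw [← Function.iterate_succ_apply' par, hj]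
    · rintro (rfl | ⟨z, ⟨hz, rfl⟩, j, rfl⟩)
      · exact ⟨0, rfl⟩
      · exact ⟨j + 1, Function.iterate_succ_apply' _ _ _⟩
  rw [h1, Finset.card_insert_of_notMem, Finset.card_biUnion, add_comm]
  · intro z hz z' hz' hne
    replace hz := (Finset.mem_filter.1 hz).2
    replace hz' := (Finset.mem_filter.1 hz').2
    rw [Function.onFun, Finset.disjoint_left]
    intro v hv hv'
    rw [mem_desc] at hv hv'
    obtain ⟨j, hj⟩ := hv
    obtain ⟨j', hj'⟩ := hv'
    have key : ∀ {a b : V} {i k : ℕ}, a ≠ r → b ≠ r → par a = y → par b = y →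
        par^[i] v = a → par^[k] v = b → i < k → False := by
      intro a b i k ha hb hay hby hi hk hik
      obtain ⟨m, rfl⟩ := Nat.exists_eq_add_of_lt hik
      have h2 : par^[m + 1] a = b := by
        rw [← hi, ← Function.iterate_add_apply, ← hk,
          show m + 1 + i = i + m + 1 by omega]
      have h3 : par^[m + 1] y = y := by
        rw [← hay, ← Function.iterate_succ_apply, Function.iterate_succ_apply', h2, hby, hay]
      have h4 := h.eq_root_of_cycle h3
      apply hb
      rw [← h2, Function.iterate_succ_apply, hay, h4, h.iterate_root]
    rcases lt_trichotomy j j' with hlt | rfl | hlt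
    · exact key hz.1 hz'.1 hz.2 hz'.2 hj hj' hlt
    · exact hne (hj.symm.trans hj')
    · exact key hz'.1 hz.1 hz'.2 hz.2 hj' hj hlt
  · simp only [Finset.mem_biUnion, Finset.mem_filter, Finset.mem_univ, true_and, mem_desc,
      not_exists, not_and]
    rintro z ⟨hz, hzy⟩ j hj
    have h2 : par^[j + 1] y = y := by rw [Function.iterate_succ_apply', hj, hzy]
    have h3 := h.eq_root_of_cycle h2
    rw [h3, h.iterate_root] at hj
    exact hz hj.symm

/-- Each vertex outside `A` enters `A` along `par` through exactly one last outside vertex, since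
`A` is never left again. -/
theorem IsParent.sum_card_desc (h : IsParent S r par) (A : Finset V) (hr : r ∈ A)
    (hA : ∀ v ∈ A, par v ∈ A) :
    ∑ z ∈ Aᶜ.filter (fun z => par z ∈ A), (desc par z).card = Aᶜ.card := by
  rw [← Finset.card_biUnion]
  · congr 1
    ext v
    simp only [Finset.mem_biUnion, Finset.mem_filter, Finset.mem_compl, mem_desc]
    constructor
    · rintro ⟨z, ⟨hz, -⟩, j, rfl⟩ hv
      exact hz (iterate_mem (A := (A : Set V)) hA hv j)
    · intro hv
      obtain ⟨j, hj⟩ := h.reach v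
      have : ∃ j, par^[j] v ∈ A := ⟨j, hj ▸ hr⟩
      induction hm : Nat.find this with
      | zero =>
        have := Nat.find_spec this
        rw [hm] at this
        exact absurd this hv
      | succ m =>
        refine ⟨par^[m] v, ⟨Nat.find_min this (by omega), ?_⟩, m, rfl⟩
        rw [← Function.iterate_succ_apply' par, Nat.succ_eq_add_one, ← hm]
        exact Nat.find_spec this
  · intro z hz z' hz' hne
    replace hz := Finset.mem_filter.1 hz
    replace hz' := Finset.mem_filter.1 hz'
    rw [Finset.mem_compl] at hz hz'
    rw [Function.onFun, Finset.disjoint_left]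
    intro v hv hv'
    rw [mem_desc] at hv hv'
    obtain ⟨j, hj⟩ := hv
    obtain ⟨j', hj'⟩ := hv'
    have key : ∀ {a b : V} {i k : ℕ}, par a ∈ A → b ∉ A →
        par^[i] v = a → par^[k] v = b → i < k → False := by
      intro a b i k ha hb hi hk hik
      obtain ⟨m, rfl⟩ := Nat.exists_eq_add_of_lt hik
      apply hb
      have : par^[m + 1] a = b := by
        rw [← hi, ← Function.iterate_add_apply, ← hk,
          show m + 1 + i = i + m + 1 by omega]
      rw [← this, Function.iterate_succ_apply]
      exact iterate_mem (A := (A : Set V)) hA ha m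
    rcases lt_trichotomy j j' with hlt | rfl | hlt
    · exact key hz.2 hz'.1 hj hj' hlt
    · exact hne (hj.symm.trans hj')
    · exact key hz'.2 hz.1 hj' hj hlt

end Descendants

/-! ### Attaching a path -/

theorem pathEdges_cons_cons (a b : V) (l : List V) :
    pathEdges (a :: b :: l) = insert s(a, b) (pathEdges (b :: l)) := by
  ext e; simp [pathEdges]

/-- The path is built backwards from its endpoint `a` in the tree, one leaf at a time. -/
theorem Grown.attach {T : PartialTree V} (hT : Grown r T) {a : V} (ha : a ∈ T.verts)
    (q : List V) (hq : q.Nodup) (hd : ∀ v ∈ q, v ∉ T.verts) :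
    Grown r ⟨T.verts ∪ {v | v ∈ q ++ [a]}, T.edges ∪ pathEdges (q ++ [a])⟩ := by
  induction q with
  | nil =>
    have h1 : T.verts ∪ {v | v ∈ [] ++ [a]} = T.verts := by simpa using ha
    have h2 : T.edges ∪ pathEdges ([] ++ [a]) = T.edges := by simp [pathEdges]
    rw [h1, h2]; exact hT
  | cons b q ih =>
    have hT' := ih hq.of_cons fun v hv => hd v (List.mem_cons_of_mem _ hv)
    obtain ⟨c, l, hl⟩ : ∃ c l, q ++ [a] = c :: l := by
      cases q <;> simp
    have hc : c ∈ T.verts ∪ {v | v ∈ q ++ [a]} := Or.inr (by simp [hl])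
    have hb : b ∉ T.verts ∪ {v | v ∈ q ++ [a]} := by
      rintro (h | h)
      · exact hd b (by simp) h
      · rcases List.mem_append.1 h with h | h
        · exact (List.nodup_cons.1 hq).1 h
        · rw [List.mem_singleton.1 h] at hd
          exact hd a (by simp) ha
    convert hT'.step hc hb using 2
    · ext v
      simp only [List.cons_append, List.mem_cons, Set.mem_union, Set.mem_ofPred_eq,
        Set.mem_insert_iff]
      tauto
    · rw [List.cons_append, hl, pathEdges_cons_cons, Sym2.eq_swap, Set.union_insert]

theorem Grown.attach_ncard [Finite V] {T : PartialTree V} {a : V} (ha : a ∈ T.verts)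
    (q : List V) (hq : q.Nodup) (hd : ∀ v ∈ q, v ∉ T.verts) :
    (T.verts ∪ {v | v ∈ q ++ [a]}).ncard = T.verts.ncard + q.length := by
  classical
  have h1 : T.verts ∪ {v | v ∈ q ++ [a]} = T.verts ∪ {v | v ∈ q} := by
    ext v
    simp only [Set.mem_union, Set.mem_ofPred_eq, List.mem_append, List.mem_singleton]
    constructor
    · rintro (h | h | rfl) <;> tauto
    · tauto
  rw [h1]
  rw [Set.ncard_union_eq (s := T.verts) (t := {v | v ∈ q})
    (Set.disjoint_left.2 fun v hv (hvq : v ∈ q) => hd v hvq hv)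
    (Set.toFinite _) (Set.toFinite _)]
  congr 1
  have : {v | v ∈ q} = (q.toFinset : Set V) := by ext; simp
  rw [this, Set.ncard_coe_finset, List.toFinset_card_of_nodup hq]

/-- A Wilson branch stays compatible with `S` exactly when it follows the parents all the way, which
is why `chainLength` below is the right statistic. -/
theorem Grown.attach_subset_iff {T : PartialTree V} (hT : Grown r T) (h : IsParent S r par)
    {a : V} (ha : a ∈ T.verts) (q : List V) (hq : q.Nodup) (hd : ∀ v ∈ q, v ∉ T.verts) :
    T.edges ∪ pathEdges (q ++ [a]) ⊆ S.edgeSet ↔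
      T.edges ⊆ S.edgeSet ∧ (q ++ [a]).IsChain (fun u v => par u = v) := by
  induction q with
  | nil => simp [pathEdges]
  | cons b q ih =>
    have hd' : ∀ v ∈ q, v ∉ T.verts := fun v hv => hd v (List.mem_cons_of_mem _ hv)
    have hT' := hT.attach ha q hq.of_cons hd'
    obtain ⟨c, l, hl⟩ : ∃ c l, q ++ [a] = c :: l := by
      cases q <;> simp
    have hc : c ∈ T.verts ∪ {v | v ∈ q ++ [a]} := Or.inr (by simp [hl])
    have hb : b ∉ T.verts ∪ {v | v ∈ q ++ [a]} := by
      rintro (h | h)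
      · exact hd b (by simp) h
      · rcases List.mem_append.1 h with h | h
        · exact (List.nodup_cons.1 hq).1 h
        · rw [List.mem_singleton.1 h] at hd
          exact hd a (by simp) ha
    have := hT'.insert_subset_iff h hc hb
    have ih' := ih hq.of_cons hd'
    simp only at this
    rw [ih', hl] at this
    rw [List.cons_append, hl, pathEdges_cons_cons, Sym2.eq_swap, Set.union_insert, this,
      List.isChain_cons_cons]
    tauto

end Trees

/-! ### First times and measurability -/

theorem firstTime_le {p : ℕ → Prop} {t : ℕ} (h : p t) : firstTime p ≤ t :=
  sInf_le ⟨t, rfl, h⟩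

theorem le_firstTime {p : ℕ → Prop} {a : ℕ∞} (h : ∀ t : ℕ, p t → a ≤ t) : a ≤ firstTime p :=
  le_sInf (by rintro _ ⟨t, rfl, ht⟩; exact h t ht)

theorem firstTime_eq {p : ℕ → Prop} {t : ℕ} (h : p t) (hlt : ∀ s < t, ¬ p s) :
    firstTime p = t :=
  le_antisymm (firstTime_le h) <| le_firstTime fun s hs => by
    by_contra hn
    exact hlt s (by exact_mod_cast not_le.1 hn) hs

theorem firstTime_eq_top {p : ℕ → Prop} (h : ∀ t, ¬ p t) : firstTime p = ⊤ :=
  top_le_iff.1 (le_firstTime fun t ht => absurd ht (h t))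

theorem firstTime_eq_coe_iff {p : ℕ → Prop} {t : ℕ} :
    firstTime p = t ↔ p t ∧ ∀ s < t, ¬ p s := by
  refine ⟨fun h => ?_, fun h => firstTime_eq h.1 h.2⟩
  classical
  by_cases hp : ∃ t, p t
  · have h1 := firstTime_eq (Nat.find_spec hp) fun s hs => Nat.find_min hp hs
    have h2 : Nat.find hp = t := by exact_mod_cast h1.symm.trans h
    rw [← h2]
    exact ⟨Nat.find_spec hp, fun s hs => Nat.find_min hp hs⟩
  · push Not at hp
    rw [firstTime_eq_top hp] at h
    exact absurd h (ENat.top_ne_natCast t)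

section Measurability

variable {V : Type*} [Finite V]

instance : Finite (PartialTree V) :=
  Finite.of_injective (fun T => (T.verts, T.edges)) fun S T h => by
    ext1
    · exact congrArg Prod.fst h
    · exact congrArg Prod.snd h

theorem measurable_outcome [MeasurableSpace V] {F : (ℕ → V) → Outcome V}
    (h : ∀ T, MeasurableSet {x | F x = some T}) : Measurable F := by
  refine measurable_to_countable' fun o => ?_
  cases o with
  | some T => exact h T
  | none =>
    have : F ⁻¹' {none} = (⋃ T, {x | F x = some T})ᶜ := by
      ext x
      simp [Option.eq_none_iff_forall_ne_some]
    rw [this]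
    exact (MeasurableSet.iUnion h).compl

variable [MeasurableSpace V] [DiscreteMeasurableSpace V]

/-- With finitely many prefixes, such an event is the preimage of a finite set. -/
theorem measurableSet_of_prefix (t : ℕ) (E : Set (ℕ → V))
    (h : ∀ x y : ℕ → V, (∀ j ≤ t, x j = y j) → x ∈ E → y ∈ E) : MeasurableSet E := by
  set res : (ℕ → V) → (Fin (t + 1) → V) := fun x j => x j with hres
  have hm : Measurable res := measurable_pi_lambda _ fun j => measurable_pi_apply _
  have : E = res ⁻¹' (res '' E) := by
    refine Set.Subset.antisymm (Set.subset_preimage_image _ _) ?_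
    rintro y ⟨x, hx, hxy⟩
    exact h x y (fun j hj => congrFun hxy ⟨j, by omega⟩) hx
  rw [this]
  exact hm (Set.toFinite _).measurableSet

end Measurability

/-! ### Loop erasure -/

section LoopErasure

variable {V : Type*}

/-- The loop erasure of `X_0, …, X_t`. -/
noncomputable def erasedPath (X : ℕ → V) (t : ℕ) : List V := loopErase ((List.range (t + 1)).map X)

theorem erasedPath_zero (X : ℕ → V) : erasedPath X 0 = [X 0] := by
  simp [erasedPath, loopErase, eraseStep]

theorem erasedPath_succ (X : ℕ → V) (t : ℕ) :
    erasedPath X (t + 1) = eraseStep (erasedPath X t) (X (t + 1)) := by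
  unfold erasedPath loopErase
  rw [List.range_succ, List.map_append, List.foldl_append]
  simp

theorem erasedPath_congr {X Y : ℕ → V} {t : ℕ} (h : ∀ j ≤ t, X j = Y j) :
    erasedPath X t = erasedPath Y t := by
  unfold erasedPath
  congr 1
  exact List.map_congr_left fun j hj => h j (by rw [List.mem_range] at hj; omega)

theorem eraseStep_of_notMem {p : List V} {v : V} (h : v ∉ p) : eraseStep p v = p ++ [v] := by
  unfold eraseStep
  congr 1
  rw [List.takeWhile_eq_self_iff]
  intro u hu
  simpa using fun huv : u = v => h (huv ▸ hu)

/-- Returning to a vertex of the path leaves a prefix, so a sum over returns becomes a sum over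
prefix lengths. -/
theorem eraseStep_of_mem [DecidableEq V] {p : List V} {v : V} (h : v ∈ p) :
    eraseStep p v = p.take (p.idxOf v + 1) := by
  induction p with
  | nil => simp at h
  | cons a p ih =>
    by_cases hav : a = v
    · subst hav
      simp [eraseStep]
    · have hv : v ∈ p := by
        rcases List.mem_cons.1 h with h | h
        · exact absurd h.symm hav
        · exact h
      have := ih hv
      unfold eraseStep at this ⊢
      rw [List.idxOf_cons_ne _ hav, List.take_succ_cons, ← this, List.takeWhile_cons_of_pos]
      · rfl
      · simpa using hav

theorem erasedPath_nodup (X : ℕ → V) (t : ℕ) : (erasedPath X t).Nodup := by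
  classical
  induction t with
  | zero => simp [erasedPath_zero]
  | succ t ih =>
    rw [erasedPath_succ]
    by_cases h : X (t + 1) ∈ erasedPath X t
    · rw [eraseStep_of_mem h]
      exact ih.sublist (List.take_sublist _ _)
    · rw [eraseStep_of_notMem h]
      exact List.nodup_append.2 ⟨ih, by simp, by
        rintro a ha b hb rfl
        exact h (List.mem_singleton.1 hb ▸ ha)⟩

theorem mem_of_mem_erasedPath {X : ℕ → V} {t : ℕ} {v : V} (h : v ∈ erasedPath X t) :
    ∃ j ≤ t, X j = v := by
  induction t with
  | zero =>
    rw [erasedPath_zero, List.mem_singleton] at h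
    exact ⟨0, le_rfl, h.symm⟩
  | succ t ih =>
    rw [erasedPath_succ, eraseStep, List.mem_append, List.mem_singleton] at h
    rcases h with h | h
    · obtain ⟨j, hj, hjv⟩ := ih (List.takeWhile_subset _ h)
      exact ⟨j, by omega, hjv⟩
    · exact ⟨t + 1, le_rfl, h.symm⟩

theorem head?_erasedPath (X : ℕ → V) (t : ℕ) : (erasedPath X t).head? = some (X 0) := by
  classical
  induction t with
  | zero => simp [erasedPath_zero]
  | succ t ih =>
    rw [erasedPath_succ]
    by_cases h : X (t + 1) ∈ erasedPath X t
    · rw [eraseStep_of_mem h, List.head?_take]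
      simpa using ih
    · rw [eraseStep_of_notMem h, List.head?_append, ih]
      rfl

/-- The loop erasure of a walk stopped when it hits `A`. -/
theorem erasedPath_of_hit {X : ℕ → V} {t : ℕ} {A : Set V} (ht : X t ∈ A)
    (hlt : ∀ j < t, X j ∉ A) :
    ∃ q : List V, erasedPath X t = q ++ [X t] ∧ q.Nodup ∧ ∀ v ∈ q, v ∉ A := by
  cases t with
  | zero => exact ⟨[], by simp [erasedPath_zero]⟩
  | succ t =>
    have hd : ∀ v ∈ erasedPath X t, v ∉ A := by
      intro v hv
      obtain ⟨j, hj, rfl⟩ := mem_of_mem_erasedPath hv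
      exact hlt j (by omega)
    refine ⟨erasedPath X t, ?_, erasedPath_nodup X t, hd⟩
    rw [erasedPath_succ, eraseStep_of_notMem]
    exact fun h => hd _ h ht

theorem addBranch_of_hit {T : PartialTree V} {X : ℕ → V} {t : ℕ} (ht : X t ∈ T.verts)
    (hlt : ∀ j < t, X j ∉ T.verts) :
    addBranch T X = some ⟨T.verts ∪ {v | v ∈ erasedPath X t},
      T.edges ∪ pathEdges (erasedPath X t)⟩ := by
  have h := firstTime_eq (p := fun t => X t ∈ T.verts) ht hlt
  unfold addBranch
  simp only [h]
  rw [if_neg (ENat.natCast_ne_top t)]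
  simp [erasedPath]

theorem addBranch_of_not_hit {T : PartialTree V} {X : ℕ → V} (h : ∀ t, X t ∉ T.verts) :
    addBranch T X = none := by
  unfold addBranch
  simp only [firstTime_eq_top h, if_true]

theorem addBranch_eq_some_iff {T T' : PartialTree V} {X : ℕ → V} :
    addBranch T X = some T' ↔ ∃ t, X t ∈ T.verts ∧ (∀ j < t, X j ∉ T.verts) ∧
      ⟨T.verts ∪ {v | v ∈ erasedPath X t}, T.edges ∪ pathEdges (erasedPath X t)⟩ = T' := by
  classical
  constructor
  · intro h
    by_cases hX : ∃ t, X t ∈ T.verts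
    · refine ⟨Nat.find hX, Nat.find_spec hX, fun j hj => Nat.find_min hX hj, ?_⟩
      rw [addBranch_of_hit (Nat.find_spec hX) fun j hj => Nat.find_min hX hj] at h
      exact Option.some.inj h
    · push Not at hX
      simp [addBranch_of_not_hit hX] at h
  · rintro ⟨t, ht, hlt, h⟩
    rw [addBranch_of_hit ht hlt, h]

theorem Grown.addBranch {r : V} {T T' : PartialTree V} (hT : Grown r T) {X : ℕ → V}
    (h : addBranch T X = some T') : Grown r T' := by
  obtain ⟨t, ht, hlt, rfl⟩ := addBranch_eq_some_iff.1 h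
  obtain ⟨q, hq, hnd, hd⟩ := erasedPath_of_hit ht hlt
  rw [hq]
  exact hT.attach ht q hnd hd

theorem measurable_addBranch [Finite V] [MeasurableSpace V] [DiscreteMeasurableSpace V]
    (T : PartialTree V) : Measurable (addBranch T) := by
  refine measurable_outcome fun T' => ?_
  simp only [addBranch_eq_some_iff, Set.ofPred_exists]
  refine MeasurableSet.iUnion fun t => measurableSet_of_prefix t _ ?_
  rintro x y hxy ⟨ht, hlt, h⟩
  refine ⟨hxy t le_rfl ▸ ht, fun j hj => hxy j hj.le ▸ hlt j hj, ?_⟩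
  rw [← erasedPath_congr hxy, h]

end LoopErasure

/-! ### The weight of a partial tree -/

section Weight

variable {V : Type*} [Fintype V]

/-- The probability that a uniform spanning tree which contains a given tree on `k` vertices is a
given one. -/
noncomputable def wt (V : Type*) [Fintype V] (k : ℕ) : ℝ :=
  (Fintype.card V : ℝ) ^ (k + 1) / (k * (Fintype.card V : ℝ) ^ Fintype.card V)

theorem wt_card [Nonempty V] : wt V (Fintype.card V) = 1 := by
  have := card_pos_real (V := V)
  unfold wt
  rw [pow_succ']
  field_simp

theorem wt_nonneg (k : ℕ) : 0 ≤ wt V k := by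
  unfold wt; positivity

open Classical in
/-- The probability that a procedure that completes a partial tree uniformly returns `S`. -/
noncomputable def value (S : SimpleGraph V) : Outcome V → ℝ
  | none => 0
  | some T => if T.edges ⊆ S.edgeSet then wt V T.verts.ncard else 0

theorem value_some_of_subset {S : SimpleGraph V} {T : PartialTree V} (h : T.edges ⊆ S.edgeSet) :
    value S (some T) = wt V T.verts.ncard := if_pos h

theorem value_some_of_not_subset {S : SimpleGraph V} {T : PartialTree V}
    (h : ¬ T.edges ⊆ S.edgeSet) : value S (some T) = 0 := if_neg h

theorem value_nonneg (S : SimpleGraph V) (o : Outcome V) : 0 ≤ value S o := by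
  cases o with
  | none => exact le_rfl
  | some T =>
    by_cases h : T.edges ⊆ S.edgeSet
    · rw [value_some_of_subset h]; exact wt_nonneg _
    · rw [value_some_of_not_subset h]

theorem exists_value_le (S : SimpleGraph V) : ∃ K, ∀ o : Outcome V, |value S o| ≤ K := by
  obtain ⟨K, hK⟩ := (Set.finite_range fun o : Outcome V => |value S o|).bddAbove
  exact ⟨K, fun o => hK ⟨o, rfl⟩⟩

variable [MeasurableSpace V] [DiscreteMeasurableSpace V]

theorem integrable_value (S : SimpleGraph V) (v : V) {F : (ℕ → V) → Outcome V}
    (hF : Measurable F) :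
    Integrable (fun x => value S (F x)) (walkLaw (completeWithLoops V) v) := by
  obtain ⟨K, hK⟩ := exists_value_le S
  exact Integrable.of_bound (((measurable_from_top (f := value S)).comp hF).aestronglyMeasurable) K
    (Filter.Eventually.of_forall fun x => (Real.norm_eq_abs _).le.trans (hK _))

end Weight

/-! ### The law of a branch of Wilson's algorithm -/

section ChainLength

variable {V : Type*} {par : V → V}

open Classical in
/-- The length of the longest initial segment of a list along which each entry is followed by its
parent. -/
noncomputable def chainLength (par : V → V) : List V → ℕ
  | [] => 0
  | [_] => 1
  | a :: b :: l => if par a = b then chainLength par (b :: l) + 1 else 1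

theorem chainLength_cons_cons_of_eq {a b : V} (h : par a = b) (l : List V) :
    chainLength par (a :: b :: l) = chainLength par (b :: l) + 1 := by
  simp [chainLength, h]

theorem chainLength_cons_cons_of_ne {a b : V} (h : par a ≠ b) (l : List V) :
    chainLength par (a :: b :: l) = 1 := by
  simp [chainLength, h]

theorem chainLength_le : ∀ p : List V, chainLength par p ≤ p.length
  | [] => by simp [chainLength]
  | [_] => by simp [chainLength]
  | a :: b :: l => by
    have := chainLength_le (b :: l)
    by_cases h : par a = b
    · rw [chainLength_cons_cons_of_eq h, List.length_cons]; omega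
    · rw [chainLength_cons_cons_of_ne h, List.length_cons]; omega

theorem chainLength_pos : ∀ {p : List V}, p ≠ [] → 1 ≤ chainLength par p
  | [], h => absurd rfl h
  | [_], _ => by simp [chainLength]
  | a :: b :: l, _ => by
    by_cases h : par a = b
    · rw [chainLength_cons_cons_of_eq h]; omega
    · rw [chainLength_cons_cons_of_ne h]

theorem chainLength_eq_length_iff :
    ∀ p : List V, chainLength par p = p.length ↔ p.IsChain (fun u v => par u = v)
  | [] => by simp [chainLength]
  | [_] => by simp [chainLength]
  | a :: b :: l => by
    rw [List.isChain_cons_cons, ← chainLength_eq_length_iff (b :: l)]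
    by_cases h : par a = b
    · rw [chainLength_cons_cons_of_eq h, List.length_cons]; simp [h]
    · rw [chainLength_cons_cons_of_ne h]; simp [h]

theorem chainLength_take : ∀ (p : List V) (j : ℕ),
    chainLength par (p.take j) = min (chainLength par p) j
  | [], j => by simp [chainLength]
  | [_], 0 => by simp [chainLength]
  | [_], j + 1 => by simp [chainLength]
  | a :: b :: l, 0 => by simp [chainLength]
  | a :: b :: l, 1 => by
    have := chainLength_pos (par := par) (List.cons_ne_nil a (b :: l))
    simp only [List.take_succ_cons, List.take_zero]
    rw [min_eq_right this]
    simp [chainLength]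
  | a :: b :: l, j + 2 => by
    have := chainLength_take (b :: l) (j + 1)
    rw [List.take_succ_cons] at this ⊢
    rw [List.take_succ_cons]
    by_cases h : par a = b
    · rw [chainLength_cons_cons_of_eq h, chainLength_cons_cons_of_eq h, this]; omega
    · rw [chainLength_cons_cons_of_ne h, chainLength_cons_cons_of_ne h]; omega

theorem chainLength_append_of_not_isChain {w : V} : ∀ {p : List V}, p ≠ [] →
    ¬ (p ++ [w]).IsChain (fun u v => par u = v) → chainLength par (p ++ [w]) = chainLength par p
  | [], h, _ => absurd rfl h
  | [a], _, hc => by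
    have h : par a ≠ w := by simpa using hc
    simp only [List.cons_append, List.nil_append]
    rw [chainLength_cons_cons_of_ne h]
    simp [chainLength]
  | a :: b :: l, _, hc => by
    simp only [List.cons_append] at hc ⊢
    rw [List.isChain_cons_cons] at hc
    by_cases h : par a = b
    · rw [chainLength_cons_cons_of_eq h, chainLength_cons_cons_of_eq h]
      have := chainLength_append_of_not_isChain (w := w) (List.cons_ne_nil b l)
        fun hc' => hc ⟨h, hc'⟩
      rw [List.cons_append] at this
      rw [this]
    · rw [chainLength_cons_cons_of_ne h, chainLength_cons_cons_of_ne h]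

theorem isChain_append_iff {v w : V} : ∀ {p : List V}, p.head? = some v →
    ((p ++ [w]).IsChain (fun a b => par a = b) ↔
      p.IsChain (fun a b => par a = b) ∧ w = par^[p.length] v)
  | [], h => by simp at h
  | [a], h => by
    obtain rfl : a = v := by simpa using h
    simp [eq_comm]
  | a :: b :: l, h => by
    obtain rfl : a = v := by simpa using h
    have := isChain_append_iff (v := b) (w := w) (p := b :: l) rfl
    simp only [List.cons_append] at this ⊢
    rw [List.isChain_cons_cons, this, List.isChain_cons_cons]
    constructor
    · rintro ⟨rfl, h1, h2⟩
      exact ⟨⟨rfl, h1⟩, h2⟩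
    · rintro ⟨⟨rfl, h1⟩, h2⟩
      exact ⟨rfl, h1, h2⟩

theorem iterate_mem_of_isChain {v : V} : ∀ {p : List V}, p.head? = some v →
    p.IsChain (fun a b => par a = b) → ∀ j < p.length, par^[j] v ∈ p
  | [], h, _, _, _ => by simp at h
  | [a], h, _, j, hj => by
    obtain rfl : a = v := by simpa using h
    obtain rfl : j = 0 := by simpa using hj
    simp
  | a :: b :: l, h, hc, 0, _ => by
    obtain rfl : a = v := by simpa using h
    simp
  | a :: b :: l, h, hc, j + 1, hj => by
    obtain rfl : a = v := by simpa using h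
    rw [List.isChain_cons_cons] at hc
    refine List.mem_cons_of_mem _ ?_
    rw [Function.iterate_succ_apply, hc.1]
    exact iterate_mem_of_isChain (p := b :: l) rfl hc.2 j (by simpa using hj)

theorem exists_iterate_of_isChain {v u : V} : ∀ {p : List V}, p.head? = some v →
    p.IsChain (fun a b => par a = b) → u ∈ p → ∃ j < p.length, par^[j] v = u
  | [], h, _, _ => by simp at h
  | [a], h, _, hu => by
    obtain rfl : a = v := by simpa using h
    obtain rfl : u = a := by simpa using hu
    exact ⟨0, by simp, rfl⟩
  | a :: b :: l, h, hc, hu => by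
    obtain rfl : a = v := by simpa using h
    rw [List.isChain_cons_cons] at hc
    rcases List.mem_cons.1 hu with rfl | hu
    · exact ⟨0, by simp, rfl⟩
    · obtain ⟨j, hj, rfl⟩ := exists_iterate_of_isChain (p := b :: l) rfl hc.2 hu
      exact ⟨j + 1, by simpa using hj, by rw [Function.iterate_succ_apply, hc.1]⟩

end ChainLength

/-! ### Explicit solution of the recursion for the loop-erased path -/

section Profile

/-- The increments of `devWeight`. -/
noncomputable def weightIncr (n : ℝ) (k m a : ℕ) : ℝ :=
  (m + k) * n ^ a / (n ^ (m + 1) * ((a + k) * (a + k - 1)))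

/-- The probability that the loop erasure of the walk is finally the prescribed path of length `m`,
if the current loop erasure has left it after `c` vertices. -/
noncomputable def devWeight (n : ℝ) (k m c : ℕ) : ℝ :=
  ∑ a ∈ Finset.range c, weightIncr n k m (a + 1)

/-- The probability that the loop erasure of the walk is finally the prescribed path of length `m`,
if the current loop erasure consists of its first `c` vertices. -/
noncomputable def pathWeight (n : ℝ) (k m c : ℕ) : ℝ :=
  devWeight n k m c + (c + k - 1) * weightIncr n k m c

theorem devWeight_succ (n : ℝ) (k m c : ℕ) :
    devWeight n k m (c + 1) = devWeight n k m c + weightIncr n k m (c + 1) :=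
  Finset.sum_range_succ _ _

/-- This is the one-step equation after the path has been left: the non-absorbing steps that change
the weight are those cutting the loop erasure back onto the path. Taking differences in `c` dictates
the form of `pathWeight`. -/
theorem sum_pathWeight (n : ℝ) (k m c : ℕ) :
    ∑ a ∈ Finset.range c, pathWeight n k m (a + 1) = (c + k) * devWeight n k m c := by
  induction c with
  | zero => simp [devWeight]
  | succ c ih =>
    rw [Finset.sum_range_succ, ih, pathWeight, devWeight_succ]
    push_cast
    ring

/-- What remains of the on-path equation after eliminating `pathWeight`: a first-order recursion
whose solutions are multiples of n^c / ((c + k)(c + k - 1)). -/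
theorem weightIncr_succ {n : ℝ} (hn : 0 < n) {k : ℕ} (hk : 1 ≤ k) (m : ℕ) {c : ℕ} (hc : 1 ≤ c) :
    (c + k + 1) * weightIncr n k m (c + 1) = n * ((c + k - 1) * weightIncr n k m c) := by
  obtain ⟨k, rfl⟩ := Nat.exists_eq_add_of_le' hk
  unfold weightIncr
  push_cast
  have h1 : (c : ℝ) + (k + 1) - 1 = c + k := by ring
  have h2 : (c : ℝ) + 1 + (k + 1) - 1 = c + k + 1 := by ring
  have h3 : (0 : ℝ) < c := by exact_mod_cast hc
  rw [h1, h2, pow_succ n c]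
  field_simp
  ring

/-- The equation on the path before its end: one step extends it, and all others together contribute
(n - 1) `devWeight`. -/
theorem pathWeight_succ {n : ℝ} (hn : 0 < n) {k : ℕ} (hk : 1 ≤ k) (m : ℕ) {c : ℕ} (hc : 1 ≤ c) :
    pathWeight n k m (c + 1) = n * pathWeight n k m c - (n - 1) * devWeight n k m c := by
  have := weightIncr_succ hn hk m hc
  unfold pathWeight
  rw [devWeight_succ]
  push_cast
  linear_combination this

/-- At the end of the path the one good step hits the tree and contributes 1. This fixes the
constant in `weightIncr`. -/
theorem pathWeight_last {n : ℝ} (hn : 0 < n) {k : ℕ} (hk : 1 ≤ k) {m : ℕ} (hm : 1 ≤ m) :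
    n * pathWeight n k m m = n * devWeight n k m m + 1 := by
  obtain ⟨k, rfl⟩ := Nat.exists_eq_add_of_le' hk
  unfold pathWeight weightIncr
  push_cast
  have h1 : (m : ℝ) + (k + 1) - 1 = m + k := by ring
  have h3 : (0 : ℝ) < m := by exact_mod_cast hm
  rw [h1, pow_succ n m]
  field_simp

/-- The starting value, equal to the ratio of the tree weights at `k` and `k + m` vertices. -/
theorem pathWeight_one {n : ℝ} (hn : 0 < n) {k : ℕ} (hk : 1 ≤ k) (m : ℕ) :
    pathWeight n k m 1 = (m + k) / (n ^ m * k) := by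
  have h3 : (0 : ℝ) < k := by exact_mod_cast hk
  unfold pathWeight
  rw [devWeight_succ]
  simp only [devWeight, Finset.range_zero, Finset.sum_empty, weightIncr]
  push_cast
  have h1 : (1 : ℝ) + k - 1 = k := by ring
  rw [h1, pow_succ n m]
  field_simp
  ring

end Profile

/-! ### The one-step equation in terms of the current loop erasure -/

section Profile

variable {V : Type*} [Fintype V] {par : V → V}

open Classical in
/-- The probability that the loop erasure of the walk is finally a chain, given its current loop
erasure. -/
noncomputable def chainProb (par : V → V) (k m : ℕ) (p : List V) : ℝ :=
  if chainLength par p = p.length then pathWeight (Fintype.card V) k m (chainLength par p)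
  else devWeight (Fintype.card V) k m (chainLength par p)

theorem chainProb_take_succ {p : List V} {k m j : ℕ} (hj : j < p.length) :
    chainProb par k m (p.take (j + 1)) =
      if j < chainLength par p then pathWeight (Fintype.card V) k m (j + 1)
      else devWeight (Fintype.card V) k m (chainLength par p) := by
  unfold chainProb
  rw [chainLength_take, List.length_take, min_eq_left (by omega : j + 1 ≤ p.length)]
  by_cases h : j < chainLength par p
  · rw [min_eq_right (by omega), if_pos rfl, if_pos h]
  · rw [min_eq_left (by omega), if_neg (by omega), if_neg h]

theorem sum_chainProb_take (p : List V) (k m : ℕ) :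
    ∑ j ∈ Finset.range p.length, chainProb par k m (p.take (j + 1)) =
      (p.length + k) * devWeight (Fintype.card V) k m (chainLength par p) := by
  have hle := chainLength_le (par := par) p
  rw [Finset.sum_congr rfl fun j hj => chainProb_take_succ (Finset.mem_range.1 hj)]
  obtain ⟨e, he⟩ := Nat.exists_eq_add_of_le hle
  rw [he, Finset.sum_range_add,
    Finset.sum_congr rfl fun j hj => if_pos (Finset.mem_range.1 hj), sum_pathWeight,
    Finset.sum_congr rfl fun j _ => if_neg (by omega)]
  simp only [Finset.sum_const, Finset.card_range, nsmul_eq_mul]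
  push_cast
  ring

theorem sum_chainProb_eraseStep_of_mem [DecidableEq V] {p : List V} (hp : p.Nodup) (k m : ℕ) :
    ∑ w ∈ p.toFinset, chainProb par k m (eraseStep p w) =
      (p.length + k) * devWeight (Fintype.card V) k m (chainLength par p) := by
  rw [← sum_chainProb_take]
  refine Finset.sum_bij (fun w _ => p.idxOf w) ?_ ?_ ?_ ?_
  · intro w hw
    simpa using List.idxOf_lt_length_iff.2 (List.mem_toFinset.1 hw)
  · intro a ha b _ hab
    exact (List.idxOf_inj (List.mem_toFinset.1 ha)).1 hab
  · intro j hj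
    have hj := Finset.mem_range.1 hj
    exact ⟨p[j], by simp, hp.idxOf_getElem j hj⟩
  · intro w hw
    rw [eraseStep_of_mem (List.mem_toFinset.1 hw)]

-- The next vertex is in `A` (the walk is absorbed), on `p` (`p` is cut back), or new (`p` is
-- extended). `m` is the length of the path in `S` from `v` to `A`.
open Classical in
theorem chainProb_step [DecidableEq V] {S : SimpleGraph V} {r : V} (h : IsParent S r par)
    (A : Finset V) (hr : r ∈ A) {v : V} {m : ℕ}
    (hm : par^[m] v ∈ A) (hlt : ∀ j < m, par^[j] v ∉ A)
    {p : List V} (hp : p.Nodup) (hv : p.head? = some v) (hd : ∀ u ∈ p, u ∉ A) :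
    (Fintype.card V : ℝ) * chainProb par A.card m p =
      ∑ w ∈ A, (if (p ++ [w]).IsChain (fun a b => par a = b) then 1 else 0) +
      ∑ w ∈ Aᶜ, chainProb par A.card m (eraseStep p w) := by
  have hp0 : p ≠ [] := by rintro rfl; simp at hv
  have : Nonempty V := ⟨v⟩
  have hn : (0 : ℝ) < Fintype.card V := card_pos_real
  have hk : 1 ≤ A.card := Finset.card_pos.2 ⟨r, hr⟩
  set n : ℝ := (Fintype.card V : ℝ) with hn'
  set B : Finset V := (A ∪ p.toFinset)ᶜ with hB
  have hsub : p.toFinset ⊆ Aᶜ := fun u hu => Finset.mem_compl.2 (hd u (List.mem_toFinset.1 hu))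
  have hsd : Aᶜ \ p.toFinset = B := by
    ext u; simp [hB]
  have hBcard : (B.card : ℝ) = n - A.card - p.length := by
    have h1 : (A ∪ p.toFinset).card = A.card + p.length := by
      rw [Finset.card_union_of_disjoint, List.toFinset_card_of_nodup hp]
      exact Finset.disjoint_left.2 fun u hu hup => hd u (List.mem_toFinset.1 hup) hu
    have h2 := Finset.card_add_card_compl (A ∪ p.toFinset)
    rw [h1] at h2
    have h3 : ((A.card + p.length + B.card : ℕ) : ℝ) = n := by rw [hn', ← h2]
    push_cast at h3
    linarith
  have hsplit : ∑ w ∈ Aᶜ, chainProb par A.card m (eraseStep p w) =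
      (p.length + A.card) * devWeight n A.card m (chainLength par p) +
        ∑ w ∈ B, chainProb par A.card m (p ++ [w]) := by
    rw [← Finset.sum_sdiff hsub, hsd, sum_chainProb_eraseStep_of_mem hp, add_comm]
    congr 1
    refine Finset.sum_congr rfl fun w hw => ?_
    rw [eraseStep_of_notMem]
    intro hwp
    simp [hB, hwp] at hw
  have happ : ∀ w, ¬ (p ++ [w]).IsChain (fun a b => par a = b) →
      chainProb par A.card m (p ++ [w]) = devWeight n A.card m (chainLength par p) := by
    intro w hw
    unfold chainProb
    rw [if_neg (by rwa [chainLength_eq_length_iff]), chainLength_append_of_not_isChain hp0 hw]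
  rw [hsplit]
  by_cases hc : p.IsChain (fun a b => par a = b)
  · have hlen := (chainLength_eq_length_iff p).2 hc
    have hL1 : 1 ≤ p.length := List.length_pos_iff.2 hp0
    have hQ : chainProb par A.card m p = pathWeight n A.card m p.length := by
      unfold chainProb
      rw [if_pos hlen, hlen]
    -- A longer chain would contain `par^[m] v`, which lies in `A`.
    have hLm : p.length ≤ m := by
      by_contra hlt'
      exact hd _ (iterate_mem_of_isChain hv hc m (by omega)) hm
    have hwp : par^[p.length] v ∉ p := by
      intro hmem
      obtain ⟨j, hj, hjv⟩ := exists_iterate_of_isChain hv hc hmem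
      obtain ⟨e, he⟩ := Nat.exists_eq_add_of_lt hj
      have h1 : par^[e + 1] (par^[p.length] v) = par^[p.length] v := by
        conv_lhs => rw [← hjv]
        rw [← Function.iterate_add_apply]
        congr 2
        omega
      have h2 := h.eq_root_of_cycle h1
      rw [h2] at hmem
      exact hd r hmem hr
    have hiff : ∀ w, (p ++ [w]).IsChain (fun a b => par a = b) ↔ w = par^[p.length] v := fun w => by
      rw [isChain_append_iff hv, and_iff_right hc]
    rw [hQ, hlen]
    -- The only good continuation is `par^[p.length] v`; it lies outside `A` if `p.length < m`, and
    -- in `A` if `p.length = m`.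
    rcases hLm.lt_or_eq with hlt' | heq
    · have hwA := hlt _ hlt'
      have hwB : par^[p.length] v ∈ B := by simp [hB, hwA, hwp]
      rw [Finset.sum_eq_zero fun w hw => if_neg ((hiff w).not.2 (by rintro rfl; exact hwA hw)),
        ← Finset.add_sum_erase _ _ hwB,
        Finset.sum_congr rfl fun w hw => happ w ((hiff w).not.2 (Finset.ne_of_mem_erase hw)),
        Finset.sum_const, Finset.card_erase_of_mem hwB, nsmul_eq_mul, Nat.cast_sub
          (Finset.card_pos.2 ⟨_, hwB⟩), hBcard, hlen]
      have hQ' : chainProb par A.card m (p ++ [par^[p.length] v]) =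
          pathWeight n A.card m (p.length + 1) := by
        have := (chainLength_eq_length_iff (p ++ [par^[p.length] v])).2 ((hiff _).2 rfl)
        unfold chainProb
        rw [if_pos this, this]
        simp [hn']
      rw [hQ', pathWeight_succ hn hk m hL1]
      push_cast
      ring
    · have hwA : par^[p.length] v ∈ A := heq ▸ hm
      rw [Finset.sum_congr rfl fun w _ => if_congr (hiff w) rfl rfl, Finset.sum_ite_eq', if_pos hwA,
        Finset.sum_congr rfl fun w hw => happ w ((hiff w).not.2 (by
          rintro rfl; simp [hB, hwA] at hw)),
        Finset.sum_const, nsmul_eq_mul, hBcard, hlen, heq,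
        pathWeight_last hn hk (heq ▸ hL1)]
      ring
  · have hiff : ∀ w, ¬ (p ++ [w]).IsChain (fun a b => par a = b) := fun w hw =>
      hc hw.left_of_append
    rw [Finset.sum_eq_zero fun w _ => if_neg (hiff w),
      Finset.sum_congr rfl fun w _ => happ w (hiff w), Finset.sum_const, nsmul_eq_mul, hBcard]
    unfold chainProb
    rw [if_neg ((chainLength_eq_length_iff p).not.2 hc)]
    ring

end Profile

/-! ### A Wilson branch preserves the expected value -/

section Branch

variable {V : Type*} [Fintype V] [MeasurableSpace V] [DiscreteMeasurableSpace V]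
  {S : SimpleGraph V} {r : V} {par : V → V}

/-- A branch compatible with `S` must be the path of length `m` from `v` to `T` in `S`, so the final
value is `wt V (k + m)` or 0, where `k` is the size of `T`. The probability of success is
`chainProb` at the one-vertex path. -/
theorem integral_value_addBranch (h : IsParent S r par) {T : PartialTree V} (hT : Grown r T)
    {v : V} (hv : v ∉ T.verts) :
    ∫ x, value S (addBranch T x) ∂walkLaw (completeWithLoops V) v = value S (some T) := by
  classical
  by_cases hs : T.edges ⊆ S.edgeSet
  swap
  · rw [value_some_of_not_subset hs]
    have : ∀ x, value S (addBranch T x) = 0 := by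
      intro x
      cases hx : addBranch T x with
      | none => rfl
      | some T' =>
        obtain ⟨t, -, -, rfl⟩ := addBranch_eq_some_iff.1 hx
        exact value_some_of_not_subset fun hs' => hs (Set.subset_union_left.trans hs')
    simp [this]
  set A : Finset V := T.verts.toFinset with hAdef
  have hmemA : ∀ u, u ∈ A ↔ u ∈ T.verts := fun u => by simp [hAdef]
  have hcardA : T.verts.ncard = A.card := by rw [hAdef, Set.ncard_eq_toFinset_card']
  have hr : r ∈ A := (hmemA r).2 hT.root_mem
  have hA : ∀ u ∈ A, par u ∈ A := fun u hu =>
    (hmemA _).2 (hT.parent_closed h hs u ((hmemA u).1 hu))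
  have hex : ∃ m, par^[m] v ∈ A := by
    obtain ⟨j, hj⟩ := h.reach v
    exact ⟨j, hj ▸ hr⟩
  obtain ⟨m, hm, hlt⟩ : ∃ m, par^[m] v ∈ A ∧ ∀ j < m, par^[j] v ∉ A :=
    ⟨Nat.find hex, Nat.find_spec hex, fun j hj => Nat.find_min hex hj⟩
  have : Nonempty V := ⟨v⟩
  have hn : (0 : ℝ) < Fintype.card V := card_pos_real
  have hk : 1 ≤ A.card := Finset.card_pos.2 ⟨r, hr⟩
  set c : ℝ := wt V (A.card + m) with hc
  obtain ⟨K, hK⟩ := exists_value_le S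
  have hint := integrable_value S v (measurable_addBranch T)
  set f : (ℕ → V) → ℝ := fun x => value S (addBranch T x) with hf
  have h_hit : ∀ (t : ℕ) (x : ℕ → V), x 0 = v → (∀ j ≤ t, x j ∉ A) → ∀ w ∈ A,
      condMean v f (t + 1) (Function.update x (t + 1) w) =
        c * (if (erasedPath x t ++ [w]).IsChain (fun a b => par a = b) then 1 else 0) := by
    intro t x hx hxA w hw
    refine condMean_of_const (by simpa using hx) fun y hy => ?_
    rw [cyl_succ_eq] at hy
    obtain ⟨hy1, hy2⟩ := hy
    have hy2 : y (t + 1) = w := hy2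
    have ha : y (t + 1) ∈ T.verts := by rw [hy2]; exact (hmemA w).1 hw
    have hl : ∀ j < t + 1, y j ∉ T.verts := fun j hj => by
      rw [hy1 j (by omega), ← hmemA]; exact hxA j (by omega)
    have hd : ∀ u ∈ erasedPath y t, u ∉ T.verts := by
      intro u hu
      obtain ⟨j, hj, rfl⟩ := mem_of_mem_erasedPath hu
      exact hl j (by omega)
    have hpath : erasedPath y (t + 1) = erasedPath x t ++ [w] := by
      rw [erasedPath_succ, eraseStep_of_notMem fun hmem => hd _ hmem ha, hy2,
        erasedPath_congr hy1]
    rw [erasedPath_congr hy1] at hd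
    rw [hy2] at ha
    have hiff := hT.attach_subset_iff h ha _ (erasedPath_nodup x t) hd
    simp only [hf]
    rw [addBranch_of_hit (hy2 ▸ ha) hl, hpath]
    split_ifs with hch
    · rw [value_some_of_subset (hiff.2 ⟨hs, hch⟩),
        Grown.attach_ncard ha _ (erasedPath_nodup x t) hd, hcardA, hc, mul_one]
      -- The absorbed chain has exactly `m` vertices before `w`: both its length and `m` are the
      -- first time at which the iterates of `par` from `v` enter `A`.
      congr 2
      have hhead : (erasedPath x t).head? = some v := by rw [head?_erasedPath, hx]
      have h1 := (isChain_append_iff hhead).1 hch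
      refine le_antisymm ?_ ?_
      · by_contra hlt'
        exact hd _ (iterate_mem_of_isChain hhead h1.1 m (by omega)) ((hmemA _).1 hm)
      · by_contra hlt'
        exact hlt _ (by omega) (h1.2 ▸ hw)
    · rw [value_some_of_not_subset fun hsub => hch (hiff.1 hsub).2, mul_zero]
  -- Loop erasures have no repetitions, so only finitely many lists matter and the guess is bounded.
  obtain ⟨K', hK'⟩ : ∃ K', ∀ p : List V, p.length ≤ Fintype.card V →
      |c * chainProb par A.card m p| ≤ K' := by
    obtain ⟨K', hK'⟩ := ((List.finite_length_le V (Fintype.card V)).image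
      fun p => |c * chainProb par A.card m p|).bddAbove
    exact ⟨K', fun p hp => hK' ⟨p, hp, rfl⟩⟩
  have key := eq_zero_of_killed (V := V) (σ := ℕ × (ℕ → V))
    (fun s => s.2 0 = v ∧ ∀ j ≤ s.1, s.2 j ∉ A)
    (fun s a => (s.1 + 1, Function.update s.2 (s.1 + 1) a)) Aᶜ
    (by rw [Finset.card_compl]; have := Finset.card_le_univ A; omega)
    (fun s => condMean v f s.1 s.2 - c * chainProb par A.card m (erasedPath s.2 s.1)) (K + K')
    (fun s hs => (abs_sub _ _).trans (add_le_add (abs_condMean_le hs.1 fun y => hK _)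
      (hK' _ (erasedPath_nodup _ _).length_le_card)))
    (fun s hs a ha => by
      refine ⟨by simpa using hs.1, fun j hj => ?_⟩
      simp only at hj ⊢
      rcases Nat.lt_or_ge j (s.1 + 1) with hj' | hj'
      · rw [Function.update_of_ne (by omega)]
        exact hs.2 j (by omega)
      · obtain rfl : j = s.1 + 1 := by omega
        simpa using ha)
    (fun s hs => by
      obtain ⟨t, x⟩ := s
      obtain ⟨hx, hxA⟩ := hs
      simp only at hx hxA ⊢
      have hd : ∀ u ∈ erasedPath x t, u ∉ A := by
        intro u hu
        obtain ⟨j, hj, rfl⟩ := mem_of_mem_erasedPath hu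
        exact hxA j hj
      have h1 := chainProb_step h A hr hm hlt (erasedPath_nodup x t)
        (by rw [head?_erasedPath, hx]) hd
      have h2 : ∀ w, erasedPath (Function.update x (t + 1) w) (t + 1) =
          eraseStep (erasedPath x t) w := fun w => by
        rw [erasedPath_succ, Function.update_self]
        congr 1
        exact erasedPath_congr fun j hj => Function.update_of_ne (by omega) _ _
      rw [mul_sub, condMean_step v hint, ← Finset.sum_add_sum_compl A,
        Finset.sum_congr rfl fun w hw => h_hit t x hx hxA w hw, Finset.sum_sub_distrib,
        ← Finset.mul_sum, ← Finset.mul_sum]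
      simp only [h2]
      linear_combination (-c) * h1)
    (s := (0, fun _ => v)) ⟨rfl, fun j _ => fun hmem => hv ((hmemA v).1 hmem)⟩
  simp only at key
  rw [condMean_zero v f rfl, erasedPath_zero, sub_eq_zero] at key
  rw [key, value_some_of_subset hs, hcardA, hc]
  have h1 : chainProb par A.card m [v] = pathWeight (Fintype.card V) A.card m 1 := by
    simp [chainProb, chainLength]
  rw [h1, pathWeight_one hn hk, wt, wt]
  have hk' : (0 : ℝ) < A.card := by exact_mod_cast hk
  push_cast
  field_simp
  ring

end Branch

/-! ### The Aldous-Broder tree and its branches along a trajectory -/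

section AldousBroderPaths

variable {V : Type*} {X Y : ℕ → V} {t : ℕ}

theorem visited_zero (X : ℕ → V) : visited X 0 = {X 0} := by
  ext v; simp [visited, eq_comm]

theorem visited_succ (X : ℕ → V) (t : ℕ) :
    visited X (t + 1) = insert (X (t + 1)) (visited X t) := by
  ext v
  constructor
  · rintro ⟨k, hk, rfl⟩
    rcases Nat.lt_or_ge k (t + 1) with h | h
    · exact Or.inr ⟨k, by omega, rfl⟩
    · obtain rfl : k = t + 1 := by omega
      exact Or.inl rfl
  · rintro (rfl | ⟨k, hk, rfl⟩)
    · exact ⟨t + 1, le_rfl, rfl⟩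
    · exact ⟨k, by omega, rfl⟩

theorem visited_mono (X : ℕ → V) {s t : ℕ} (h : s ≤ t) : visited X s ⊆ visited X t := by
  rintro v ⟨k, hk, rfl⟩
  exact ⟨k, hk.trans h, rfl⟩

theorem visited_congr (h : ∀ j ≤ t, X j = Y j) : visited X t = visited Y t := by
  ext v
  exact ⟨fun ⟨k, hk, hv⟩ => ⟨k, hk, (h k hk).symm.trans hv⟩,
    fun ⟨k, hk, hv⟩ => ⟨k, hk, (h k hk).trans hv⟩⟩

theorem fresh_succ_iff : Fresh X (t + 1) ↔ X (t + 1) ∉ visited X t := by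
  constructor
  · rintro h ⟨k, hk, hkt⟩
    exact h k (by omega) hkt
  · intro h k hk hkt
    exact h ⟨k, by omega, hkt⟩

theorem fresh_congr (h : ∀ j ≤ t, X j = Y j) : Fresh X t ↔ Fresh Y t := by
  unfold Fresh
  rw [h t le_rfl]
  exact forall₂_congr fun k hk => by rw [h k hk.le]

theorem aldousBroderTree_zero (X : ℕ → V) : aldousBroderTree X 0 = ⟨{X 0}, ∅⟩ := by
  ext1
  · exact visited_zero X
  · simp [aldousBroderTree]

theorem aldousBroderTree_succ_of_fresh (h : X (t + 1) ∉ visited X t) :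
    aldousBroderTree X (t + 1) = ⟨insert (X (t + 1)) (aldousBroderTree X t).verts,
      insert s(X t, X (t + 1)) (aldousBroderTree X t).edges⟩ := by
  ext1
  · exact visited_succ X t
  · ext e
    constructor
    · rintro ⟨k, hk, hf, rfl⟩
      rcases Nat.lt_or_ge k t with hkt | hkt
      · exact Or.inr ⟨k, hkt, hf, rfl⟩
      · obtain rfl : k = t := by omega
        exact Or.inl rfl
    · rintro (rfl | ⟨k, hk, hf, rfl⟩)
      · exact ⟨t, by omega, fresh_succ_iff.2 h, rfl⟩
      · exact ⟨k, by omega, hf, rfl⟩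

theorem aldousBroderTree_succ_of_mem (h : X (t + 1) ∈ visited X t) :
    aldousBroderTree X (t + 1) = aldousBroderTree X t := by
  ext1
  · exact (visited_succ X t).trans (Set.insert_eq_of_mem h)
  · ext e
    constructor
    · rintro ⟨k, hk, hf, rfl⟩
      rcases Nat.lt_or_ge k t with hkt | hkt
      · exact ⟨k, hkt, hf, rfl⟩
      · obtain rfl : k = t := by omega
        exact absurd h (fresh_succ_iff.1 hf)
    · rintro ⟨k, hk, hf, rfl⟩
      exact ⟨k, by omega, hf, rfl⟩

theorem aldousBroderTree_congr (h : ∀ j ≤ t, X j = Y j) :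
    aldousBroderTree X t = aldousBroderTree Y t := by
  ext1
  · exact visited_congr h
  · ext e
    refine exists_congr fun k => and_congr_right fun hk => and_congr ?_ ?_
    · exact fresh_congr fun j hj => h j (by omega)
    · rw [h k hk.le, h (k + 1) hk]

theorem grown_aldousBroderTree {r : V} (h : X 0 = r) (t : ℕ) : Grown r (aldousBroderTree X t) := by
  induction t with
  | zero => rw [aldousBroderTree_zero, h]; exact Grown.base
  | succ t ih =>
    by_cases ht : X (t + 1) ∈ visited X t
    · rwa [aldousBroderTree_succ_of_mem ht]
    · rw [aldousBroderTree_succ_of_fresh ht]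
      exact ih.step ⟨t, le_rfl, rfl⟩ ht

theorem aldousBroderTree_eq_of_not_fresh {s : ℕ} (hst : s ≤ t)
    (h : ∀ u, s < u → u ≤ t → ¬ Fresh X u) : aldousBroderTree X t = aldousBroderTree X s := by
  induction t, hst using Nat.le_induction with
  | base => rfl
  | succ t hst ih =>
    rw [aldousBroderTree_succ_of_mem, ih fun u hu hut => h u hu (by omega)]
    by_contra hn
    exact h (t + 1) (by omega) le_rfl (fresh_succ_iff.2 hn)

theorem coverTime_le (h : visited X t = Set.univ) : coverTime X ≤ t := firstTime_le h

theorem lt_coverTime (h : visited X t ≠ Set.univ) : ((t + 1 : ℕ) : ℕ∞) ≤ coverTime X :=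
  le_firstTime fun s hs => by
    by_contra hn
    have hst : s ≤ t := by
      have : (s : ℕ∞) < ((t + 1 : ℕ) : ℕ∞) := not_le.1 hn
      have : s < t + 1 := by exact_mod_cast this
      omega
    exact h (Set.univ_subset_iff.1 (hs ▸ visited_mono X hst))

theorem nextOut_coverTime (X : ℕ → V) : nextOut X (coverTime X) = coverTime X :=
  min_eq_right (le_firstTime fun _ ht => ht.1.le)

theorem nextIn_coverTime (X : ℕ → V) : nextIn X (coverTime X) = coverTime X :=
  min_eq_right (le_firstTime fun _ ht => ht.1.le)

/-- After covering, the capped times are frozen and all further branches are empty. -/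
theorem sigmaIn_eq_coverTime {i j : ℕ} (hij : j ≤ i) (h : sigmaIn X j = coverTime X) :
    sigmaIn X i = coverTime X := by
  induction i, hij using Nat.le_induction with
  | base => exact h
  | succ i _ ih => rw [sigmaIn, ih, nextOut_coverTime, nextIn_coverTime]

theorem sigmaIn_le_coverTime (X : ℕ → V) : ∀ i, sigmaIn X i ≤ coverTime X
  | 0 => zero_le
  | _ + 1 => min_le_right _ _

theorem branchTree_of_sigmaIn {i : ℕ} (h : sigmaIn X i = t) :
    branchTree i X = some (aldousBroderTree X t) := by
  unfold branchTree
  rw [h, if_neg (ENat.natCast_ne_top t), ENat.toNat_natCast]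

theorem branchTree_eq_some_iff {i : ℕ} {T : PartialTree V} :
    branchTree i X = some T ↔ ∃ t : ℕ, sigmaIn X i = t ∧ aldousBroderTree X t = T := by
  constructor
  · intro h
    by_cases hs : sigmaIn X i = ⊤
    · simp [branchTree, hs] at h
    · obtain ⟨t, ht⟩ := ENat.ne_top_iff_exists.1 hs
      refine ⟨t, ht.symm, ?_⟩
      rw [branchTree_of_sigmaIn ht.symm] at h
      exact Option.some.inj h
  · rintro ⟨t, ht, rfl⟩
    exact branchTree_of_sigmaIn ht

/-- At time `t` the first `j` branches are finished and the next one has not been started. -/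
structure InPhase (X : ℕ → V) (j t : ℕ) : Prop where
  le : sigmaIn X j ≤ t
  not_fresh : ∀ s : ℕ, sigmaIn X j < s → s ≤ t → ¬ Fresh X s
  not_covered : visited X t ≠ Set.univ

/-- At time `t` the first `j` branches are finished and the next one is under way. -/
structure OutPhase (X : ℕ → V) (j t : ℕ) : Prop where
  le : nextOut X (sigmaIn X j) ≤ t
  fresh : ∀ s : ℕ, nextOut X (sigmaIn X j) < s → s ≤ t → Fresh X s
  le_coverTime : (t : ℕ∞) ≤ coverTime X

theorem InPhase.succ {j : ℕ} (h : InPhase X j t) (ht : X (t + 1) ∈ visited X t) :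
    InPhase X j (t + 1) where
  le := h.le.trans (by exact_mod_cast Nat.le_succ t)
  not_fresh s hs hst := by
    rcases Nat.lt_or_ge s (t + 1) with h' | h'
    · exact h.not_fresh s hs (by omega)
    · obtain rfl : s = t + 1 := by omega
      exact fun hf => fresh_succ_iff.1 hf ht
  not_covered := by
    rw [visited_succ, Set.insert_eq_of_mem ht]
    exact h.not_covered

theorem InPhase.outPhase {j : ℕ} (h : InPhase X j t) (ht : X (t + 1) ∉ visited X t) :
    OutPhase X j (t + 1) := by
  have h1 : firstTime (fun s : ℕ => sigmaIn X j < s ∧ Fresh X s) = (t + 1 : ℕ) :=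
    firstTime_eq ⟨h.le.trans_lt (by exact_mod_cast Nat.lt_succ_self t), fresh_succ_iff.2 ht⟩
      fun s hs hs' => h.not_fresh s hs'.1 (by omega) hs'.2
  have h2 := lt_coverTime h.not_covered
  have h3 : nextOut X (sigmaIn X j) = (t + 1 : ℕ) := by
    unfold nextOut
    rw [h1, min_eq_left h2]
  refine ⟨h3.le, fun s hs hst => ?_, h2⟩
  rw [h3] at hs
  have : t + 1 < s := by exact_mod_cast hs
  omega

theorem OutPhase.succ {j : ℕ} (h : OutPhase X j t) (hc : visited X t ≠ Set.univ)
    (ht : X (t + 1) ∉ visited X t) : OutPhase X j (t + 1) where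
  le := h.le.trans (by exact_mod_cast Nat.le_succ t)
  fresh s hs hst := by
    rcases Nat.lt_or_ge s (t + 1) with h' | h'
    · exact h.fresh s hs (by omega)
    · obtain rfl : s = t + 1 := by omega
      exact fresh_succ_iff.2 ht
  le_coverTime := lt_coverTime hc

theorem OutPhase.inPhase {j : ℕ} (h : OutPhase X j t) (hc : visited X t ≠ Set.univ)
    (ht : X (t + 1) ∈ visited X t) : InPhase X (j + 1) (t + 1) := by
  have h1 : firstTime (fun s : ℕ => nextOut X (sigmaIn X j) < s ∧ ¬ Fresh X s) = (t + 1 : ℕ) :=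
    firstTime_eq ⟨h.le.trans_lt (by exact_mod_cast Nat.lt_succ_self t),
      fun hf => fresh_succ_iff.1 hf ht⟩
      fun s hs hs' => hs'.2 (h.fresh s hs'.1 (by omega))
  have h3 : sigmaIn X (j + 1) = (t + 1 : ℕ) := by
    rw [sigmaIn, nextIn, h1, min_eq_left (lt_coverTime hc)]
  refine ⟨h3.le, fun s hs hst => ?_, ?_⟩
  · rw [h3] at hs
    have : t + 1 < s := by exact_mod_cast hs
    omega
  · rw [visited_succ, Set.insert_eq_of_mem ht]
    exact hc

/-- Covering happens in the middle of a branch and finishes it, because of the cap at the cover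
time. -/
theorem OutPhase.branchTree {i j : ℕ} (h : OutPhase X j t) (hc : visited X t = Set.univ)
    (hij : j + 1 ≤ i) : branchTree i X = some (aldousBroderTree X t) := by
  have hcov : coverTime X = t := le_antisymm (coverTime_le hc) h.le_coverTime
  have h1 : sigmaIn X (j + 1) = coverTime X := by
    rw [sigmaIn, nextIn, min_eq_right]
    rw [hcov]
    refine le_firstTime fun s hs => ?_
    by_contra hn
    have hst : s < t := by exact_mod_cast not_le.1 hn
    exact hs.2 (h.fresh s hs.1 hst.le)
  exact branchTree_of_sigmaIn ((sigmaIn_eq_coverTime hij h1).trans hcov)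

/-- The tree may be read off at any time before the next branch starts, since it does not change
meanwhile. -/
theorem InPhase.branchTree {i : ℕ} (h : InPhase X i t) :
    branchTree i X = some (aldousBroderTree X t) := by
  obtain ⟨s, hs⟩ := ENat.ne_top_iff_exists.1 (h.le.trans_lt (ENat.natCast_lt_top t)).ne
  have hst : s ≤ t := by exact_mod_cast hs.trans_le h.le
  rw [branchTree_of_sigmaIn hs.symm, aldousBroderTree_eq_of_not_fresh hst fun u hu hut =>
    h.not_fresh u (by rw [← hs]; exact_mod_cast hu) hut]

theorem inPhase_zero (h : visited X 0 ≠ Set.univ) : InPhase X 0 0 where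
  le := le_rfl
  not_fresh s hs hst := by
    obtain rfl : s = 0 := by omega
    exact absurd hs (lt_irrefl _)
  not_covered := h

end AldousBroderPaths

/-! ### Measurability of the branch times and of the branch tree -/

section BranchMeasurability

theorem measurableSet_of_levels {α : Type*} [MeasurableSpace α] {f : α → ℕ∞}
    (hf : ∀ s, MeasurableSet {a | f a = s}) (F : Set ℕ∞) : MeasurableSet {a | f a ∈ F} := by
  have : {a | f a ∈ F} = ⋃ s ∈ F, {a | f a = s} := by ext; simp
  rw [this]
  exact MeasurableSet.biUnion F.to_countable fun s _ => hf s

theorem measurableSet_min_eq {α : Type*} [MeasurableSpace α] {f g : α → ℕ∞}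
    (hf : ∀ s, MeasurableSet {a | f a = s}) (hg : ∀ s, MeasurableSet {a | g a = s}) (s : ℕ∞) :
    MeasurableSet {a | min (f a) (g a) = s} := by
  have : {a | min (f a) (g a) = s} =
      ({a | f a = s} ∩ {a | g a ∈ Set.Ici s}) ∪ ({a | g a = s} ∩ {a | f a ∈ Set.Ici s}) := by
    ext a
    simp only [Set.mem_ofPred_eq, Set.mem_union, Set.mem_inter_iff, Set.mem_Ici, min_eq_iff]
    constructor
    · rintro (⟨h1, h2⟩ | ⟨h1, h2⟩)
      · exact Or.inl ⟨h1, h1 ▸ h2⟩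
      · exact Or.inr ⟨h1, h1 ▸ h2⟩
    · rintro (⟨h1, h2⟩ | ⟨h1, h2⟩)
      · exact Or.inl ⟨h1, h1 ▸ h2⟩
      · exact Or.inr ⟨h1, h1 ▸ h2⟩
  rw [this]
  exact ((hf s).inter (measurableSet_of_levels hg _)).union
    ((hg s).inter (measurableSet_of_levels hf _))

theorem measurableSet_firstTime_eq {α : Type*} [MeasurableSpace α] {p : α → ℕ → Prop}
    (hp : ∀ t, MeasurableSet {a | p a t}) (s : ℕ∞) : MeasurableSet {a | firstTime (p a) = s} := by
  have hnat : ∀ t : ℕ, MeasurableSet {a | firstTime (p a) = t} := by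
    intro t
    simp only [firstTime_eq_coe_iff, Set.ofPred_and, Set.ofPred_forall]
    exact (hp t).inter (MeasurableSet.iInter fun s => MeasurableSet.iInter fun _ => (hp s).compl)
  induction s using ENat.recTopCoe with
  | coe t => exact hnat t
  | top =>
    have : {a | firstTime (p a) = ⊤} = (⋃ t : ℕ, {a | firstTime (p a) = t})ᶜ := by
      ext a
      simp only [Set.mem_ofPred_eq, Set.mem_compl_iff, Set.mem_iUnion]
      constructor
      · rintro h ⟨t, ht⟩
        exact ENat.top_ne_natCast t (h.symm.trans ht)
      · intro h
        by_contra hn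
        obtain ⟨t, ht⟩ := ENat.ne_top_iff_exists.1 hn
        exact h ⟨t, ht.symm⟩
    rw [this]
    exact (MeasurableSet.iUnion hnat).compl

variable {V : Type*} [Finite V] [MeasurableSpace V] [DiscreteMeasurableSpace V]

theorem measurableSet_fresh (t : ℕ) : MeasurableSet {X : ℕ → V | Fresh X t} :=
  measurableSet_of_prefix t _ fun _ _ h hx => (fresh_congr h).1 hx

theorem measurableSet_coverTime_eq (s : ℕ∞) : MeasurableSet {X : ℕ → V | coverTime X = s} :=
  measurableSet_firstTime_eq (fun t => measurableSet_of_prefix t {X | visited X t = Set.univ}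
    fun _ _ h hx => (visited_congr h).symm.trans hx) s

theorem measurableSet_sigmaIn_eq (i : ℕ) :
    ∀ s, MeasurableSet {X : ℕ → V | sigmaIn X i = s} := by
  induction i with
  | zero => intro s; exact MeasurableSet.const ((0 : ℕ∞) = s)
  | succ i ih =>
    have h1 : ∀ s, MeasurableSet {X : ℕ → V | nextOut X (sigmaIn X i) = s} :=
      measurableSet_min_eq (measurableSet_firstTime_eq fun t =>
        (measurableSet_of_levels ih (Set.Iio (t : ℕ∞))).inter (measurableSet_fresh t))
        measurableSet_coverTime_eq
    exact measurableSet_min_eq (measurableSet_firstTime_eq fun t =>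
        (measurableSet_of_levels h1 (Set.Iio (t : ℕ∞))).inter (measurableSet_fresh t).compl)
        measurableSet_coverTime_eq

theorem measurable_branchTree (i : ℕ) : Measurable (branchTree (V := V) i) := by
  refine measurable_outcome fun T => ?_
  simp only [branchTree_eq_some_iff, Set.ofPred_exists]
  refine MeasurableSet.iUnion fun t => (measurableSet_sigmaIn_eq i t).inter ?_
  exact measurableSet_of_prefix t {X | aldousBroderTree X t = T}
    fun _ _ h hx => (aldousBroderTree_congr h).symm.trans hx

end BranchMeasurability

/-! ### The law of the branches of the Aldous-Broder algorithm -/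

section BranchLaw

variable {V : Type*} {S : SimpleGraph V} {r : V} {par : V → V}

theorem visited_update (x : ℕ → V) (t : ℕ) (w : V) :
    visited (Function.update x (t + 1) w) t = visited x t :=
  visited_congr fun j hj => Function.update_of_ne (by omega) _ _

theorem aldousBroderTree_update_of_mem {x : ℕ → V} {t : ℕ} {w : V} (hw : w ∈ visited x t) :
    aldousBroderTree (Function.update x (t + 1) w) (t + 1) = aldousBroderTree x t := by
  rw [aldousBroderTree_succ_of_mem (by rwa [Function.update_self, visited_update])]
  exact aldousBroderTree_congr fun j hj => Function.update_of_ne (by omega) _ _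

theorem aldousBroderTree_update_of_notMem {x : ℕ → V} {t : ℕ} {w : V} (hw : w ∉ visited x t) :
    aldousBroderTree (Function.update x (t + 1) w) (t + 1) =
      ⟨insert w (aldousBroderTree x t).verts, insert s(x t, w) (aldousBroderTree x t).edges⟩ := by
  rw [aldousBroderTree_succ_of_fresh (by rwa [Function.update_self, visited_update]),
    Function.update_self, Function.update_of_ne (by omega)]
  have : aldousBroderTree (Function.update x (t + 1) w) t = aldousBroderTree x t :=
    aldousBroderTree_congr fun j hj => Function.update_of_ne (by omega) _ _
  rw [this]

theorem mem_cyl_of_update {x y : ℕ → V} {t : ℕ} {w : V}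
    (h : y ∈ cyl (t + 1) (Function.update x (t + 1) w)) :
    y ∈ cyl t x ∧ y (t + 1) = w ∧ visited y t = visited x t := by
  rw [cyl_succ_eq] at h
  exact ⟨h.1, h.2, visited_congr h.1⟩

/-- `j` branches are finished after the next step, if it leads to a visited vertex. -/
def InSoon (r : V) (j t : ℕ) (x : ℕ → V) : Prop :=
  x 0 = r ∧ ∀ w ∈ visited x t, ∀ y ∈ cyl (t + 1) (Function.update x (t + 1) w), InPhase y j (t + 1)

/-- `j` branches are finished and the next one is under way. -/
def Out (r : V) (j t : ℕ) (x : ℕ → V) : Prop :=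
  x 0 = r ∧ Fresh x t ∧ t ≠ 0 ∧ ∀ y ∈ cyl t x, OutPhase y j t

theorem InSoon.out {j t : ℕ} {x : ℕ → V} (hx : ∀ y ∈ cyl t x, InPhase y j t) (h0 : x 0 = r)
    {w : V} (hw : w ∉ visited x t) : Out r j (t + 1) (Function.update x (t + 1) w) := by
  refine ⟨by simpa using h0, ?_, by omega, fun y hy => ?_⟩
  · rw [fresh_succ_iff, Function.update_self, visited_update]
    exact hw
  · obtain ⟨h1, h2, h3⟩ := mem_cyl_of_update hy
    exact (hx y h1).outPhase (by rwa [h2, h3])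

variable [Fintype V]

/-- The weight per descendant of the last vertex of an unfinished branch. -/
noncomputable def branchWt (V : Type*) [Fintype V] (k : ℕ) : ℝ :=
  (Fintype.card V : ℝ) ^ k / (Fintype.card V : ℝ) ^ Fintype.card V

/-- Links the two guesses: the total over the k visited vertices when a branch is closed is the
weight of a single descendant after one more vertex. -/
theorem branchWt_succ [Nonempty V] {k : ℕ} (hk : 1 ≤ k) : k * wt V k = branchWt V (k + 1) := by
  have h1 : (0 : ℝ) < k := by exact_mod_cast hk
  have := card_pos_real (V := V)
  unfold wt branchWt
  field_simp

open Classical in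
/-- The probability that the tree is finally `S`, while a branch is under way. -/
noncomputable def openValue (S : SimpleGraph V) (par : V → V) (T : PartialTree V) (y : V) : ℝ :=
  if T.edges ⊆ S.edgeSet then branchWt V T.verts.ncard * (desc par y).card else 0

theorem openValue_insert [DecidableEq V] (h : IsParent S r par) {T : PartialTree V}
    (hT : Grown r T) (hs : T.edges ⊆ S.edgeSet) {x w : V} (hx : x ∈ T.verts) (hw : w ∉ T.verts) :
    openValue S par ⟨insert w T.verts, insert s(x, w) T.edges⟩ w =
      if par w = x then branchWt V (T.verts.ncard + 1) * (desc par w).card else 0 := by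
  unfold openValue
  simp only [hT.insert_subset_iff h hx hw, hs, true_and,
    Set.ncard_insert_of_notMem hw (Set.toFinite _)]

/-- The walk goes on from the end `w` of an unfinished branch. -/
theorem sum_openValue_insert [DecidableEq V] (h : IsParent S r par) {T : PartialTree V}
    (hT : Grown r T) {x w : V} (hx : x ∈ T.verts) (hw : w ∉ T.verts) (A : Finset V)
    (hA : (A : Set V) = insert w T.verts) :
    A.card * value S (some ⟨insert w T.verts, insert s(x, w) T.edges⟩) +
      ∑ z ∈ Aᶜ, openValue S par ⟨insert z (insert w T.verts),
        insert s(w, z) (insert s(x, w) T.edges)⟩ z =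
      Fintype.card V * openValue S par ⟨insert w T.verts, insert s(x, w) T.edges⟩ w := by
  have : Nonempty V := ⟨w⟩
  have hcard : (insert w T.verts).ncard = A.card := by rw [← hA, Set.ncard_coe_finset]
  have hmem : ∀ z, z ∈ A ↔ z = w ∨ z ∈ T.verts := fun z => by
    rw [← Finset.mem_coe, hA, Set.mem_insert_iff]
  have hT' := hT.step hx hw
  by_cases hs : insert s(x, w) T.edges ⊆ S.edgeSet
  swap
  · rw [value_some_of_not_subset hs, openValue, if_neg hs, Finset.sum_eq_zero]
    · simp
    · intro z _
      exact if_neg fun hs' => hs ((Set.subset_insert _ _).trans hs')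
  have hsT : T.edges ⊆ S.edgeSet := (Set.subset_insert _ _).trans hs
  have hwr : w ≠ r := fun hwr => hw (hwr ▸ hT.root_mem)
  have hsum : ∑ z ∈ Aᶜ, openValue S par ⟨insert z (insert w T.verts),
        insert s(w, z) (insert s(x, w) T.edges)⟩ z =
      ∑ z ∈ Aᶜ, if par z = w then branchWt V (A.card + 1) * (desc par z).card else 0 := by
    refine Finset.sum_congr rfl fun z hz => ?_
    rw [openValue_insert h hT' hs (Or.inl rfl), hcard]
    rwa [← hA, Finset.mem_coe, ← Finset.mem_compl]
  have hfil : Aᶜ.filter (fun z => par z = w) =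
      Finset.univ.filter (fun z => z ≠ r ∧ par z = w) := by
    ext z
    simp only [Finset.mem_filter, Finset.mem_compl, Finset.mem_univ, true_and, hmem, not_or]
    constructor
    · rintro ⟨⟨-, hz⟩, hzw⟩
      exact ⟨fun hzr => hz (hzr ▸ hT.root_mem), hzw⟩
    · rintro ⟨hzr, hzw⟩
      refine ⟨⟨?_, fun hz => hw (hzw ▸ hT.parent_closed h hsT z hz)⟩, hzw⟩
      rintro rfl
      exact hzr (h.eq_root_of_cycle (m := 0) hzw)
  rw [hsum, ← Finset.sum_filter, hfil, ← Finset.mul_sum, value_some_of_subset hs, openValue,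
    if_pos hs]
  simp only [hcard]
  rw [h.card_desc w, branchWt_succ (by rw [← hcard]; exact (Set.ncard_pos).2 ⟨w, Or.inl rfl⟩)]
  push_cast
  have := card_pos_real (V := V)
  unfold branchWt
  rw [pow_succ]
  ring

/-- The walk starts a new branch from a uniform vertex of the tree. -/
theorem sum_openValue [DecidableEq V] (h : IsParent S r par) {T : PartialTree V}
    (hT : Grown r T) (A : Finset V) (hA : (A : Set V) = T.verts) :
    A.card * (A.card * value S (some T)) +
      ∑ x ∈ A, ∑ z ∈ Aᶜ, openValue S par ⟨insert z T.verts, insert s(x, z) T.edges⟩ z =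
      Fintype.card V * (A.card * value S (some T)) := by
  have : Nonempty V := ⟨r⟩
  have hcard : T.verts.ncard = A.card := by rw [← hA, Set.ncard_coe_finset]
  have hmem : ∀ z, z ∈ A ↔ z ∈ T.verts := fun z => by rw [← Finset.mem_coe, hA]
  have hr : r ∈ A := (hmem r).2 hT.root_mem
  by_cases hs : T.edges ⊆ S.edgeSet
  swap
  · rw [value_some_of_not_subset hs, Finset.sum_eq_zero]
    · simp
    · intro x _
      refine Finset.sum_eq_zero fun z _ => ?_
      exact if_neg fun hs' => hs ((Set.subset_insert _ _).trans hs')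
  have hsum : ∑ x ∈ A, ∑ z ∈ Aᶜ, openValue S par ⟨insert z T.verts, insert s(x, z) T.edges⟩ z =
      ∑ z ∈ Aᶜ, if par z ∈ A then branchWt V (A.card + 1) * (desc par z).card else 0 := by
    rw [Finset.sum_comm]
    refine Finset.sum_congr rfl fun z hz => ?_
    rw [Finset.sum_congr rfl fun x hx => openValue_insert h hT hs ((hmem x).1 hx)
      fun hz' => Finset.mem_compl.1 hz ((hmem z).2 hz'), hcard, Finset.sum_ite_eq]
  have hdesc := h.sum_card_desc A hr fun v hv => (hmem _).2
    (hT.parent_closed h hs v ((hmem v).1 hv))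
  have hcompl : ((Aᶜ.card : ℕ) : ℝ) = Fintype.card V - A.card := by
    rw [Finset.card_compl, Nat.cast_sub (Finset.card_le_univ A)]
  rw [hsum, ← Finset.sum_filter, ← Finset.mul_sum, ← Nat.cast_sum, hdesc, hcompl,
    value_some_of_subset hs, hcard, branchWt_succ (Finset.card_pos.2 ⟨r, hr⟩)]
  ring

variable [MeasurableSpace V] [DiscreteMeasurableSpace V]

/-- The conditional expectation of the value of the tree of the first `i` branches. -/
noncomputable def branchMean (S : SimpleGraph V) (r : V) (i t : ℕ) (x : ℕ → V) : ℝ :=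
  condMean r (fun y => value S (branchTree i y)) t x

theorem branchMean_step (S : SimpleGraph V) (r : V) (i t : ℕ) (x : ℕ → V) :
    (Fintype.card V : ℝ) * branchMean S r i t x =
      ∑ w, branchMean S r i (t + 1) (Function.update x (t + 1) w) :=
  condMean_step r (integrable_value S r (measurable_branchTree i)) t x

/-- Induction on the number of unvisited vertices. From the end of the branch the walk either
discovers a new vertex, prolonging the branch, or returns to the visited set, where `hin` gives the
total contribution. -/
theorem branchMean_out [DecidableEq V] (h : IsParent S r par) {i j : ℕ} (hij : j + 1 ≤ i)
    (hin : ∀ (t : ℕ) (x : ℕ → V) (A : Finset V), InSoon r (j + 1) t x → (A : Set V) = visited x t →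
      ∑ w ∈ A, branchMean S r i (t + 1) (Function.update x (t + 1) w) =
        A.card * value S (some (aldousBroderTree x t))) :
    ∀ (d t : ℕ) (x : ℕ → V), (visited x t)ᶜ.ncard = d → Out r j t x →
      branchMean S r i t x = openValue S par (aldousBroderTree x t) (x t) := by
  have : Nonempty V := ⟨r⟩
  intro d
  induction d with
  | zero =>
    rintro t x hd ⟨h0, hf, ht, hout⟩
    obtain ⟨t, rfl⟩ := Nat.exists_eq_succ_of_ne_zero ht
    have hu : visited x (t + 1) = Set.univ := by
      rw [Set.ncard_eq_zero (Set.toFinite _)] at hd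
      exact Set.compl_empty_iff.1 hd
    have hf' := fresh_succ_iff.1 hf
    -- With everything visited there are no new vertices, and the identity says that the open value
    -- is already the value of the tree.
    have hstep := sum_openValue_insert h (grown_aldousBroderTree h0 t)
      (show x t ∈ visited x t from ⟨t, le_rfl, rfl⟩) (w := x (t + 1)) hf' Finset.univ
      (by rw [Finset.coe_univ, ← hu]; exact visited_succ x t)
    rw [← aldousBroderTree_succ_of_fresh hf', Finset.compl_univ, Finset.sum_empty, add_zero,
      Finset.card_univ] at hstep
    rw [← mul_left_cancel₀ (card_pos_real (V := V)).ne' hstep]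
    refine condMean_of_const h0 fun y hy => ?_
    rw [(hout y hy).branchTree ((visited_congr hy).trans hu) hij, aldousBroderTree_congr hy]
  | succ d ih =>
    rintro t x hd ⟨h0, hf, ht, hout⟩
    obtain ⟨t, rfl⟩ := Nat.exists_eq_succ_of_ne_zero ht
    have hu : visited x (t + 1) ≠ Set.univ := by
      intro hu
      rw [hu] at hd
      simp at hd
    have hf' := fresh_succ_iff.1 hf
    obtain ⟨A, hA⟩ : ∃ A : Finset V, (A : Set V) = visited x (t + 1) :=
      ⟨(visited x (t + 1)).toFinite.toFinset, by simp⟩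
    have hstep := sum_openValue_insert h (grown_aldousBroderTree h0 t)
      (show x t ∈ visited x t from ⟨t, le_rfl, rfl⟩) (w := x (t + 1)) hf' A
      (by rw [hA]; exact visited_succ x t)
    have htree := aldousBroderTree_succ_of_fresh hf'
    have hnext : ∀ z ∈ Aᶜ, branchMean S r i (t + 1 + 1) (Function.update x (t + 1 + 1) z) =
        openValue S par ⟨insert z (insert (x (t + 1)) (aldousBroderTree x t).verts),
          insert s(x (t + 1), z) (insert s(x t, x (t + 1)) (aldousBroderTree x t).edges)⟩ z := by
      intro z hz
      have hz' : z ∉ visited x (t + 1) := by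
        rwa [← hA, Finset.mem_coe, ← Finset.mem_compl]
      rw [ih]
      · rw [aldousBroderTree_update_of_notMem hz', htree, Function.update_self]
      · rw [visited_succ, Function.update_self, visited_update]
        have h1 := Set.ncard_add_ncard_compl (visited x (t + 1))
        have h2 := Set.ncard_add_ncard_compl (insert z (visited x (t + 1)))
        rw [Set.ncard_insert_of_notMem hz' (Set.toFinite _)] at h2
        rw [Nat.succ_eq_add_one] at hd
        omega
      · refine ⟨by simpa using h0, ?_, by omega, fun y hy => ?_⟩
        · rw [fresh_succ_iff, Function.update_self, visited_update]
          exact hz'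
        · obtain ⟨h1, h2, h3⟩ := mem_cyl_of_update hy
          exact (hout y h1).succ (h3 ▸ hu) (by rwa [h2, h3])
    have hsoon : InSoon r (j + 1) (t + 1) x := by
      refine ⟨h0, fun w hw y hy => ?_⟩
      obtain ⟨h1, h2, h3⟩ := mem_cyl_of_update hy
      exact (hout y h1).inPhase (h3 ▸ hu) (by rwa [h2, h3])
    refine mul_left_cancel₀ (card_pos_real (V := V)).ne' ?_
    rw [branchMean_step, ← Finset.sum_add_sum_compl A, Nat.succ_eq_add_one, hin _ _ A hsoon hA,
      Finset.sum_congr rfl hnext, htree, hstep]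

/-- Induction on the number `d` of branches still to come. Looking one step ahead in `InSoon` treats
alike a walk idling in the visited set and one whose step back closes a branch. -/
theorem sum_branchMean_in [DecidableEq V] (h : IsParent S r par) (i : ℕ) :
    ∀ (d j : ℕ), j + d = i → ∀ (t : ℕ) (x : ℕ → V) (A : Finset V), InSoon r j t x →
      (A : Set V) = visited x t →
      ∑ w ∈ A, branchMean S r i (t + 1) (Function.update x (t + 1) w) =
        A.card * value S (some (aldousBroderTree x t)) := by
  have : Nonempty V := ⟨r⟩
  intro d
  induction d with
  | zero =>
    rintro j rfl t x A ⟨h0, hin⟩ hA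
    rw [← nsmul_eq_mul]
    -- All `i` branches are finished, so the tree is already determined on each cylinder.
    refine Finset.sum_eq_card_nsmul fun w hw => ?_
    have hw' : w ∈ visited x t := hA ▸ Finset.mem_coe.2 hw
    refine condMean_of_const (by simpa using h0) fun y hy => ?_
    rw [add_zero, (hin w hw' y hy).branchTree, aldousBroderTree_congr hy,
      aldousBroderTree_update_of_mem hw']
  | succ d ih =>
    intro j hij t x A hx hA
    have hout := fun t x =>
      branchMean_out h (by omega : j + 1 ≤ i) (ih (j + 1) (by omega)) _ t x rfl
    obtain ⟨K, hK⟩ := exists_value_le S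
    set T := aldousBroderTree x t with hT
    have hgrown : Grown r T := grown_aldousBroderTree hx.1 t
    -- The state is the history while the tree is still `T`, and starting a new branch kills it. The
    -- unknown is the sum over the next visited vertex, not the mean at a given vertex, which would
    -- depend on that vertex.
    have key := eq_zero_of_killed (V := V) (σ := ℕ × (ℕ → V))
      (fun s => InSoon r j s.1 s.2 ∧ aldousBroderTree s.2 s.1 = T)
      (fun s a => (s.1 + 1, Function.update s.2 (s.1 + 1) a)) A
      (by
        have h1 : r ∈ visited x t := ⟨0, by omega, hx.1⟩
        have h2 := (hx.2 r h1 _ (mem_cyl_self _ _)).not_covered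
        rw [visited_succ, Function.update_self, visited_update, Set.insert_eq_of_mem h1, ← hA,
          Ne, Finset.coe_eq_univ] at h2
        exact (Finset.card_lt_iff_ne_univ A).2 h2)
      (fun s => ∑ w ∈ A, branchMean S r i (s.1 + 1) (Function.update s.2 (s.1 + 1) w) -
        A.card * value S (some T)) (A.card * K + A.card * K)
      (by
        rintro ⟨t, x⟩ ⟨hx, -⟩
        refine (abs_sub _ _).trans (add_le_add ((Finset.abs_sum_le_sum_abs _ _).trans ?_) ?_)
        · rw [← nsmul_eq_mul]
          exact Finset.sum_le_card_nsmul _ _ _ fun w _ =>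
            abs_condMean_le (by simpa using hx.1) fun y => hK _
        · rw [abs_mul, Nat.abs_cast]
          exact mul_le_mul_of_nonneg_left (hK _) (Nat.cast_nonneg _))
      (by
        rintro ⟨t, x⟩ ⟨hx, hxT⟩ w hw
        simp only at hx hxT ⊢
        have hw' : w ∈ visited x t := by
          have : visited x t = T.verts := by rw [← hxT]; rfl
          rw [this]
          exact (Set.ext_iff.1 hA w).1 (Finset.mem_coe.2 hw)
        rw [aldousBroderTree_update_of_mem hw']
        refine ⟨⟨by simpa using hx.1, fun z hz y hy => ?_⟩, hxT⟩
        obtain ⟨h1, h2, h3⟩ := mem_cyl_of_update hy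
        exact (hx.2 w hw' y h1).succ (by rwa [h2, h3]))
      (by
        rintro ⟨t, x⟩ ⟨hx, hxT⟩
        simp only at hx hxT ⊢
        have hvis : visited x t = T.verts := by rw [← hxT]; rfl
        have hAT : (A : Set V) = T.verts := hA
        have hnext : ∀ w ∈ A, ∀ z ∈ Aᶜ, branchMean S r i (t + 1 + 1)
            (Function.update (Function.update x (t + 1) w) (t + 1 + 1) z) =
            openValue S par ⟨insert z T.verts, insert s(w, z) T.edges⟩ z := by
          intro w hw z hz
          have hw' : w ∈ visited x t := by
            rw [hvis, ← hAT]; exact Finset.mem_coe.2 hw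
          have htr := aldousBroderTree_update_of_mem hw'
          have hz' : z ∉ visited (Function.update x (t + 1) w) (t + 1) := by
            rw [visited_succ, Function.update_self, visited_update, Set.insert_eq_of_mem hw', hvis,
              ← hAT, Finset.mem_coe, ← Finset.mem_compl]
            exact hz
          rw [hout _ _ (InSoon.out (hx.2 w hw') (by simpa using hx.1) hz'),
            aldousBroderTree_update_of_notMem hz', htr, hxT, Function.update_self,
            Function.update_self]
        have h1 := sum_openValue h hgrown A hAT
        rw [mul_sub, Finset.mul_sum, ← h1, Finset.sum_sub_distrib, Finset.sum_const, nsmul_eq_mul]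
        have h2 : ∀ w ∈ A, (Fintype.card V : ℝ) *
            branchMean S r i (t + 1) (Function.update x (t + 1) w) =
            ∑ z ∈ A, branchMean S r i (t + 1 + 1)
              (Function.update (Function.update x (t + 1) w) (t + 1 + 1) z) +
            ∑ z ∈ Aᶜ, openValue S par ⟨insert z T.verts, insert s(w, z) T.edges⟩ z := by
          intro w hw
          rw [branchMean_step, ← Finset.sum_add_sum_compl A, Finset.sum_congr rfl (hnext w hw)]
        rw [Finset.sum_congr rfl h2, Finset.sum_add_distrib]
        ring)
      (s := (t, x)) ⟨hx, rfl⟩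
    exact sub_eq_zero.1 key

/-- From the root the first step either stays at `r` (total given by `sum_branchMean_in`) or opens
the first branch (`branchMean_out`). The cases of one vertex and of `i = 0` are deterministic. -/
theorem integral_value_branchTree (h : IsParent S r par) (i : ℕ) :
    ∫ x, value S (branchTree i x) ∂walkLaw (completeWithLoops V) r =
      value S (some ⟨{r}, ∅⟩) := by
  classical
  have : Nonempty V := ⟨r⟩
  rw [← condMean_zero r (fun y => value S (branchTree i y)) (x := fun _ => r) rfl]
  have hdet : (∀ y ∈ cyl 0 (fun _ => r), branchTree i y = some (aldousBroderTree y 0)) →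
      condMean r (fun y => value S (branchTree i y)) 0 (fun _ => r) =
        value S (some ⟨{r}, ∅⟩) := by
    intro hy
    refine condMean_of_const rfl fun y hy' => ?_
    rw [hy y hy', aldousBroderTree_congr hy', aldousBroderTree_zero]
  by_cases hu : visited (fun _ : ℕ => r) 0 = Set.univ
  · refine hdet fun y hy => branchTree_of_sigmaIn ?_
    have hc : coverTime y = (0 : ℕ) :=
      le_antisymm (coverTime_le ((visited_congr hy).trans hu)) zero_le
    exact (sigmaIn_eq_coverTime (zero_le (a := i)) (j := 0) hc.symm).trans hc
  have hin : ∀ y ∈ cyl 0 (fun _ => r), InPhase y 0 0 := fun y hy =>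
    inPhase_zero (visited_congr hy ▸ hu)
  rcases Nat.eq_zero_or_pos i with rfl | hi
  · exact hdet fun y hy => (hin y hy).branchTree
  have hA : (({r} : Finset V) : Set V) = visited (fun _ : ℕ => r) 0 := by
    rw [visited_zero]; simp
  have hsoon : InSoon r 0 0 (fun _ => r) := by
    refine ⟨rfl, fun w hw y hy => ?_⟩
    obtain ⟨h1, h2, h3⟩ := mem_cyl_of_update hy
    exact (hin y h1).succ (by rwa [h2, h3])
  have h1 := sum_branchMean_in h i i 0 (zero_add i) 0 _ {r} hsoon hA
  have h2 : ∀ z ∈ ({r} : Finset V)ᶜ,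
      branchMean S r i (0 + 1) (Function.update (fun _ => r) (0 + 1) z) =
      openValue S par ⟨insert z {r}, insert s(r, z) ∅⟩ z := by
    intro z hz
    have hz' : z ∉ visited (fun _ : ℕ => r) 0 := by
      rw [← hA, Finset.mem_coe, ← Finset.mem_compl]; exact hz
    rw [branchMean_out h (by omega : 0 + 1 ≤ i) (sum_branchMean_in h i (i - 1) (0 + 1) (by omega)) _
      _ _ rfl (InSoon.out hin rfl hz'), aldousBroderTree_update_of_notMem hz',
      aldousBroderTree_zero, Function.update_self]
  have h3 := sum_openValue h (Grown.base (r := r)) {r} (by simp)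
  rw [Finset.sum_singleton, Finset.card_singleton] at h3
  rw [Finset.card_singleton, aldousBroderTree_zero] at h1
  refine mul_left_cancel₀ (card_pos_real (V := V)).ne' ?_
  change (Fintype.card V : ℝ) * branchMean S r i 0 (fun _ => r) = _
  rw [branchMean_step, ← Finset.sum_add_sum_compl {r}, h1, Finset.sum_congr rfl h2]
  linear_combination h3

end BranchLaw

/-! ### Wilson's algorithm completes a partial tree uniformly -/

theorem ae_uniformOn_mem {V : Type*} [MeasurableSpace V] [DiscreteMeasurableSpace V] (s : Set V) :
    ∀ᵐ v ∂uniformOn s, v ∈ s :=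
  ae_cond_mem MeasurableSet.of_discrete

section Completion

variable {V : Type*} [Fintype V]

instance : DiscreteMeasurableSpace (Outcome V) := ⟨fun _ => trivial⟩

/-- `ν` is the law of a uniform spanning tree which contains `T`, up to normalization. -/
structure Completes (ν : Measure (Outcome V)) (T : PartialTree V) : Prop where
  prob : IsProbabilityMeasure ν
  apply_singleton : ∀ S : SimpleGraph V, S.IsTree →
    ν {some (ofSimpleGraph S)} = ENNReal.ofReal (value S (some T))
  ae_isTree : ∀ᵐ o ∂ν, ∃ S : SimpleGraph V, S.IsTree ∧ o = some (ofSimpleGraph S)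

/-- Running a correct completion after a random stage that conserves the expected value is again a
correct completion; this serves both the Wilson rounds and the Aldous–Broder stage. -/
theorem Completes.bind {μ : Measure (Outcome V)} [IsProbabilityMeasure μ]
    {run : PartialTree V → Measure (Outcome V)} {T : PartialTree V}
    (hrun : ∀ᵐ o ∂μ, ∃ T', o = some T' ∧ Completes (run T') T')
    (hval : ∀ S : SimpleGraph V, S.IsTree →
      ∫⁻ o, ENNReal.ofReal (value S o) ∂μ = ENNReal.ofReal (value S (some T))) :
    Completes (μ.bind (andThen run)) T where
  prob := by
    refine isProbabilityMeasure_bind measurable_from_top.aemeasurable ?_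
    filter_upwards [hrun]
    rintro _ ⟨T', rfl, h⟩
    exact h.prob
  apply_singleton S hS := by
    rw [Measure.bind_apply MeasurableSet.of_discrete measurable_from_top.aemeasurable, ← hval S hS]
    refine lintegral_congr_ae ?_
    filter_upwards [hrun]
    rintro _ ⟨T', rfl, h⟩
    exact h.apply_singleton S hS
  ae_isTree := by
    rw [ae_iff, Measure.bind_apply MeasurableSet.of_discrete measurable_from_top.aemeasurable,
      lintegral_eq_zero_iff measurable_from_top]
    filter_upwards [hrun]
    rintro _ ⟨T', rfl, h⟩
    exact h.ae_isTree

theorem Completes.dirac {r : V} {T : PartialTree V} (hT : Grown r T) (hu : T.verts = Set.univ) :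
    Completes (Measure.dirac (some T)) T where
  prob := inferInstance
  apply_singleton S hS := by
    have : Nonempty V := ⟨r⟩
    obtain ⟨par, h⟩ := exists_isParent hS r
    rw [Measure.dirac_apply' _ MeasurableSet.of_discrete]
    by_cases hs : T.edges ⊆ S.edgeSet
    · rw [value_some_of_subset hs, hu, Set.ncard_univ, Nat.card_eq_fintype_card, wt_card,
        Set.indicator_of_mem]
      · simp
      · rw [Set.mem_singleton_iff, (hT.subset_iff_of_verts_eq_univ h hu).1 hs]
    · rw [value_some_of_not_subset hs, Set.indicator_of_notMem]
      · simp
      · rw [Set.mem_singleton_iff, Option.some_inj]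
        exact fun h' => hs ((hT.subset_iff_of_verts_eq_univ h hu).2 h')
  ae_isTree := by
    rw [ae_dirac_eq, Filter.eventually_pure]
    obtain ⟨S, hS, hST⟩ := hT.exists_isTree hu
    exact ⟨S, hS, by rw [hST]⟩

variable [MeasurableSpace V] [DiscreteMeasurableSpace V]

theorem isProbabilityMeasure_map_walkLaw (v : V) {F : (ℕ → V) → Outcome V} (hF : Measurable F) :
    IsProbabilityMeasure ((walkLaw (completeWithLoops V) v).map F) :=
  Measure.isProbabilityMeasure_map hF.aemeasurable

theorem lintegral_value_map (S : SimpleGraph V) (v : V) {F : (ℕ → V) → Outcome V}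
    (hF : Measurable F) :
    ∫⁻ o, ENNReal.ofReal (value S o) ∂(walkLaw (completeWithLoops V) v).map F =
      ENNReal.ofReal (∫ x, value S (F x) ∂walkLaw (completeWithLoops V) v) := by
  rw [lintegral_map measurable_from_top hF, ofReal_integral_eq_lintegral_ofReal
    (integrable_value S v hF) (Filter.Eventually.of_forall fun x => value_nonneg S _)]

theorem isProbabilityMeasure_wilsonRound {T : PartialTree V} (hT : T.verts ≠ Set.univ) :
    IsProbabilityMeasure (wilsonRound (completeWithLoops V) T) := by
  have := isProbabilityMeasure_uniformOn (Set.toFinite T.vertsᶜ) (Set.nonempty_compl.2 hT)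
  exact isProbabilityMeasure_bind Measurable.of_discrete.aemeasurable
    (Filter.Eventually.of_forall fun v =>
      isProbabilityMeasure_map_walkLaw v (measurable_addBranch T))

/-- The law of the starting vertex plays no role: the value is conserved from each vertex outside
`T`. -/
theorem lintegral_value_wilsonRound {r : V} {T : PartialTree V} (hG : Grown r T)
    (hT : T.verts ≠ Set.univ) {S : SimpleGraph V} (hS : S.IsTree) :
    ∫⁻ o, ENNReal.ofReal (value S o) ∂wilsonRound (completeWithLoops V) T =
      ENNReal.ofReal (value S (some T)) := by
  obtain ⟨par, h⟩ := exists_isParent hS r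
  have := isProbabilityMeasure_uniformOn (Set.toFinite T.vertsᶜ) (Set.nonempty_compl.2 hT)
  unfold wilsonRound
  rw [Measure.lintegral_bind Measurable.of_discrete.aemeasurable measurable_from_top.aemeasurable]
  have h1 : ∀ᵐ v ∂uniformOn T.vertsᶜ,
      ∫⁻ o, ENNReal.ofReal (value S o) ∂(walkLaw (completeWithLoops V) v).map (addBranch T) =
        ENNReal.ofReal (value S (some T)) := by
    filter_upwards [ae_uniformOn_mem T.vertsᶜ] with v hv
    rw [lintegral_value_map S v (measurable_addBranch T), integral_value_addBranch h hG hv]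
  rw [lintegral_congr_ae h1, lintegral_const, measure_univ, mul_one]

/-- The walk almost surely meets the root, hence the tree, and its starting vertex survives loop
erasure, so the tree grows strictly and the rounds suffice. -/
theorem ae_wilsonRound {r : V} {T : PartialTree V} (hG : Grown r T) :
    ∀ᵐ o ∂wilsonRound (completeWithLoops V) T,
      ∃ T', o = some T' ∧ Grown r T' ∧ T'.vertsᶜ.ncard < T.vertsᶜ.ncard := by
  unfold wilsonRound
  rw [ae_iff, Measure.bind_apply MeasurableSet.of_discrete Measurable.of_discrete.aemeasurable,
    lintegral_eq_zero_iff Measurable.of_discrete]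
  filter_upwards [ae_uniformOn_mem T.vertsᶜ] with v hv
  change ((walkLaw (completeWithLoops V) v).map (addBranch T)) _ = 0
  rw [← ae_iff, ae_map_iff (measurable_addBranch T).aemeasurable MeasurableSet.of_discrete]
  filter_upwards [ae_walkLaw_zero v, ae_hits v r] with x hx0 hxr
  classical
  have hX : ∃ t, x t ∈ T.verts := by
    obtain ⟨t, ht⟩ := hxr
    exact ⟨t, ht ▸ hG.root_mem⟩
  have hb := addBranch_of_hit (Nat.find_spec hX) fun j hj => Nat.find_min hX hj
  refine ⟨_, hb, hG.addBranch hb, Set.ncard_lt_ncard ?_ (Set.toFinite _)⟩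
  refine Set.ssubset_iff_subset_ne.2 ⟨Set.compl_subset_compl.2 Set.subset_union_left, fun heq => ?_⟩
  have hv' : v ∉ T.verts ∪ {u | u ∈ erasedPath x (Nat.find hX)} := by
    rw [← Set.mem_compl_iff, heq]; exact hv
  exact hv' (Or.inr (List.mem_of_head? (by rw [head?_erasedPath, hx0])))

theorem completes_wilsonLoop {r : V} : ∀ (k : ℕ) {T : PartialTree V}, Grown r T →
    T.vertsᶜ.ncard ≤ k → Completes (wilsonLoop (completeWithLoops V) k T) T := by
  intro k
  induction k with
  | zero =>
    intro T hG hk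
    have hu : T.verts = Set.univ :=
      Set.compl_empty_iff.1 ((Set.ncard_eq_zero (Set.toFinite _)).1 (Nat.le_zero.1 hk))
    rw [wilsonLoop, if_pos hu]
    exact Completes.dirac hG hu
  | succ k ih =>
    intro T hG hk
    rw [wilsonLoop]
    split_ifs with hu
    · exact Completes.dirac hG hu
    · have := isProbabilityMeasure_wilsonRound hu
      refine Completes.bind ?_ fun S hS => lintegral_value_wilsonRound hG hu hS
      filter_upwards [ae_wilsonRound hG]
      rintro _ ⟨T', rfl, hG', hlt⟩
      exact ⟨T', rfl, ih hG' (by omega)⟩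

theorem completes_wilson {r : V} {T : PartialTree V} (hG : Grown r T) :
    Completes (wilson (completeWithLoops V) T) T :=
  completes_wilsonLoop _ hG (by rw [← Set.ncard_univ]; exact Set.ncard_le_ncard (Set.subset_univ _))

theorem ae_aldousBroderLaw (r : V) (i : ℕ) :
    ∀ᵐ o ∂aldousBroderLaw (completeWithLoops V) r i, ∃ T, o = some T ∧ Grown r T := by
  unfold aldousBroderLaw
  rw [ae_map_iff (measurable_branchTree i).aemeasurable MeasurableSet.of_discrete]
  filter_upwards [ae_walkLaw_zero r, ae_all_iff.2 fun w => ae_hits r w] with x hx0 hx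
  choose τ hτ using hx
  have hcov : visited x (Finset.univ.sup τ) = Set.univ :=
    Set.eq_univ_of_forall fun w => ⟨τ w, Finset.le_sup (Finset.mem_univ w), hτ w⟩
  have hne : sigmaIn x i ≠ ⊤ :=
    (((sigmaIn_le_coverTime x i).trans (coverTime_le hcov)).trans_lt (ENat.natCast_lt_top _)).ne
  obtain ⟨t, ht⟩ := ENat.ne_top_iff_exists.1 hne
  exact ⟨_, branchTree_of_sigmaIn ht.symm, grown_aldousBroderTree hx0 t⟩

theorem completes_hybrid (r : V) (i : ℕ) :
    Completes ((aldousBroderLaw (completeWithLoops V) r i).bind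
      (andThen (wilson (completeWithLoops V)))) ⟨{r}, ∅⟩ := by
  have : IsProbabilityMeasure (aldousBroderLaw (completeWithLoops V) r i) :=
    isProbabilityMeasure_map_walkLaw r (measurable_branchTree i)
  refine Completes.bind ?_ fun S hS => ?_
  · filter_upwards [ae_aldousBroderLaw r i]
    rintro _ ⟨T, rfl, hG⟩
    exact ⟨T, rfl, completes_wilson hG⟩
  · obtain ⟨par, h⟩ := exists_isParent hS r
    unfold aldousBroderLaw
    rw [lintegral_value_map S r (measurable_branchTree i), integral_value_branchTree h]

end Completion

/-! ### Uniqueness of the uniform law -/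

/-- Total mass 1 forces both constants to be 1/|F|. -/
theorem eq_of_constant_on_finset {α : Type*} [Countable α] [MeasurableSpace α]
    [DiscreteMeasurableSpace α] {μ ν : Measure α} [IsProbabilityMeasure μ] [IsProbabilityMeasure ν]
    {F : Finset α} {c d : ENNReal} (hμ : ∀ a ∈ F, μ {a} = c) (hν : ∀ a ∈ F, ν {a} = d)
    (hμF : ∀ᵐ a ∂μ, a ∈ F) (hνF : ∀ᵐ a ∂ν, a ∈ F) : μ = ν := by
  have total : ∀ {ρ : Measure α} [IsProbabilityMeasure ρ] {e : ENNReal}, (∀ a ∈ F, ρ {a} = e) →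
      (∀ᵐ a ∂ρ, a ∈ F) → e = (F.card : ENNReal)⁻¹ := by
    intro ρ _ e h1 h2
    have h3 : ρ (F : Set α) = 1 := (prob_compl_eq_zero_iff MeasurableSet.of_discrete).1 h2
    rw [← sum_measure_singleton, Finset.sum_congr rfl h1, Finset.sum_const, nsmul_eq_mul,
      mul_comm] at h3
    exact ENNReal.eq_inv_of_mul_eq_one_left h3
  have hout : ∀ {ρ : Measure α} {a : α}, (∀ᵐ a ∂ρ, a ∈ F) → a ∉ F → ρ {a} = 0 :=
    fun h ha => measure_mono_null (by rintro _ rfl; exact ha) h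
  refine Measure.ext_of_singleton fun a => ?_
  by_cases ha : a ∈ F
  · rw [hμ a ha, hν a ha, total hμ hμF, total hν hνF]
  · rw [hout hμF ha, hout hνF ha]

theorem ofSimpleGraph_injective {V : Type*} :
    Function.Injective (ofSimpleGraph : SimpleGraph V → PartialTree V) :=
  fun _ _ h => SimpleGraph.edgeSet_injective (congrArg PartialTree.edges h)

instance {V : Type*} : DiscreteMeasurableSpace (SimpleGraph V) := ⟨fun _ => trivial⟩

theorem UST_apply_singleton {V : Type*} [Finite V] {G : LoopGraph V} {S : SimpleGraph V}
    (hS : S ∈ spanningTrees G) : UST G {S} = ((spanningTrees G).ncard : ENNReal)⁻¹ := by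
  unfold UST uniformOn
  rw [cond_apply MeasurableSet.of_discrete, Set.inter_eq_self_of_subset_right (by simpa using hS),
    Measure.count_singleton, mul_one, Measure.count_apply MeasurableSet.of_discrete,
    ← (Set.toFinite (spanningTrees G)).cast_ncard_eq, ENat.toENNReal_coe]

theorem Completes.eq_UST {V : Type*} [Fintype V] {ν : Measure (Outcome V)} {r : V}
    (h : Completes ν ⟨{r}, ∅⟩) :
    ν = (UST (completeWithLoops V)).map fun T => some (ofSimpleGraph T) := by
  classical
  have := h.prob
  -- A spanning tree exists because the procedure almost surely returns one; this makes `UST` a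
  -- probability measure.
  obtain ⟨-, S₀, hS₀, -⟩ := h.ae_isTree.exists
  have hmem : ∀ S : SimpleGraph V, S ∈ spanningTrees (completeWithLoops V) ↔ S.IsTree :=
    fun S => mem_spanningTrees_complete
  have hU : IsProbabilityMeasure (UST (completeWithLoops V)) :=
    isProbabilityMeasure_uniformOn (Set.toFinite _) ⟨S₀, (hmem S₀).2 hS₀⟩
  have hmeas : Measurable fun T : SimpleGraph V => (some (ofSimpleGraph T) : Outcome V) :=
    measurable_from_top
  have hinj : Function.Injective fun T : SimpleGraph V => (some (ofSimpleGraph T) : Outcome V) :=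
    (Option.some_injective _).comp ofSimpleGraph_injective
  have : IsProbabilityMeasure ((UST (completeWithLoops V)).map
      fun T => (some (ofSimpleGraph T) : Outcome V)) :=
    Measure.isProbabilityMeasure_map hmeas.aemeasurable
  obtain ⟨F, hF⟩ : ∃ F : Finset (Outcome V), ∀ o, o ∈ F ↔
      ∃ S : SimpleGraph V, S.IsTree ∧ o = some (ofSimpleGraph S) :=
    ⟨(Set.toFinite {o | ∃ S : SimpleGraph V, S.IsTree ∧ o = some (ofSimpleGraph S)}).toFinset,
      by simp⟩
  refine eq_of_constant_on_finset (F := F) (c := ENNReal.ofReal (wt V 1))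
    (d := ((spanningTrees (completeWithLoops V)).ncard : ENNReal)⁻¹) ?_ ?_ ?_ ?_
  · intro o ho
    obtain ⟨S, hS, rfl⟩ := (hF o).1 ho
    rw [h.apply_singleton S hS, value_some_of_subset (Set.empty_subset _), Set.ncard_singleton]
  · intro o ho
    obtain ⟨S, hS, rfl⟩ := (hF o).1 ho
    rw [Measure.map_apply hmeas MeasurableSet.of_discrete, ← UST_apply_singleton ((hmem S).2 hS)]
    congr 1
    ext S'
    exact hinj.eq_iff
  · simpa only [hF] using h.ae_isTree
  · rw [ae_map_iff hmeas.aemeasurable MeasurableSet.of_discrete]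
    filter_upwards [ae_uniformOn_mem (spanningTrees (completeWithLoops V))] with S hS
    exact (hF _).2 ⟨S, (hmem S).1 hS, rfl⟩

end HybridUST

theorem mainTheorem4 {V : Type*} [Finite V] [MeasurableSpace V] [DiscreteMeasurableSpace V]
    (r : V) (i : ℕ) :
    (HybridUST.aldousBroderLaw (HybridUST.completeWithLoops V) r i).bind
        (HybridUST.andThen (HybridUST.wilson (HybridUST.completeWithLoops V))) =
      (HybridUST.UST (HybridUST.completeWithLoops V)).map
        (fun T => some (HybridUST.ofSimpleGraph T)) := by
  have := Fintype.ofFinite V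
  exact (HybridUST.completes_hybrid r i).eq_UST
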